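/- Let $\mathbf A$ be a symmetric polycategory. **Formulas** are generated from the objects of $\mathbf A$ (atoms) by finite, possibly empty, sums $\sum_{i\in I}X_i$ and products $\prod_{i\in I}X_i$. A sequent $\Gamma\vdash\Delta$ consists of finitely many, distinctly named, unordered channels, each in the domain $\Gamma$ or in the codomain $\Delta$ and carrying a formula. The **terms** of the logic $\Sigma\Pi_{\mathbf A}$ are typed by sequents and are formed as follows ($I$ is a finite index set). * Every polymap $f:\Gamma\to\Delta$ of $\mathbf A$ is a term of $\Gamma\vdash\Delta$ (atomic term); this includes the identities $1_A:\alpha:A\vdash\beta:A$. * Cotuple: $\alpha\{a_i\mapsto f_i\}_{i\in I}$ of $\Gamma,\alpha:\sum_iX_i\vdash\Delta$, from terms $f_i$ of $\Gamma,\alpha:X_i\vdash\Delta$. Tuple: $\alpha(a_i\mapsto f_i)_{i\in I}$ of $\Gamma\vdash\alpha:\prod_iX_i,\Delta$, from terms $f_i$ of $\Gamma\vdash\alpha:X_i,\Delta$. Here $I$ may be empty (nullary cotuple, nullary tuple). * Projection: $\overleftarrow\alpha[a_k](f)$ of $\Gamma,\alpha:\prod_iX_i\vdash\Delta$, from a term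 $f$ of $\Gamma,\alpha:X_k\vdash\Delta$. Injection: $\overrightarrow\alpha[a_k](f)$ of $\Gamma\vdash\alpha:\sum_iX_i,\Delta$, from a term $f$ of $\Gamma\vdash\alpha:X_k,\Delta$. Here $k\in I$. * Cut: $f;_\gamma g$ of $\Gamma,\Gamma'\vdash\Delta,\Delta'$, from terms $f$ of $\Gamma\vdash\Delta,\gamma:Z$ and $g$ of $\gamma:Z,\Gamma'\vdash\Delta'$; the channel $\gamma$ is bound. Terms are identified up to renaming of bound channels, and a term carries its type. Let $\Rightarrow$ be the relation "one application, anywhere inside a term, of one of the **rewrites**" $$\begin{array}{rl} (1)& f;_\gamma 1\Rightarrow f\\ (2)& 1;_\gamma f\Rightarrow f\\ (3)& \alpha\{a_i\mapsto f_i\}_i;_\gamma g\Rightarrow\alpha\{a_i\mapsto f_i;_\gamma g\}_i\\ (4)& f;_\gamma\beta(b_i\mapsto g_i)_i\Rightarrow\beta(b_i\mapsto f;_\gamma g_i)_i\\ (5)& \overrightarrow\alpha[a_k](f);_\gamma g\Rightarrow\overrightarrow\alpha[a_k](f;_\gamma g)\\ (6)& f;_\gamma\overleftarrow\beta[b_k](g)\Rightarrow\overleftarrow\beta[b_k](f;_\gamma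 g)\\ (7)& \overleftarrow\alpha[a_k](f);_\gamma g\Rightarrow\overleftarrow\alpha[a_k](f;_\gamma g)\\ (8)& f;_\gamma\overrightarrow\beta[b_k](g)\Rightarrow\overrightarrow\beta[b_k](f;_\gamma g)\\ (9)& \alpha(a_i\mapsto f_i)_i;_\gamma g\Rightarrow\alpha(a_i\mapsto f_i;_\gamma g)_i\\ (10)& f;_\gamma\beta\{b_i\mapsto g_i\}_i\Rightarrow\beta\{b_i\mapsto f;_\gamma g_i\}_i\\ (11)& \overrightarrow\gamma[a_k](f);_\gamma\gamma\{a_i\mapsto g_i\}_i\Rightarrow f;_\gamma g_k\\ (12)& \gamma(a_i\mapsto f_i)_i;_\gamma\overleftarrow\gamma[a_k](g)\Rightarrow f_k;_\gamma g \end{array}$$ where $\alpha,\beta\ne\gamma$ and in (1), (2) the cut channel of $f$ takes the name of the remaining channel of the identity. Let $\vDash\!\!\!\dashv$ be the relation "one application, anywhere inside a term and in either direction, of one of the **permuting conversions**" $$\begin{array}{rl} (13)& \alpha\{a_i\mapsto\beta\{b_j\mapsto f_{ij}\}_j\}_i = \beta\{b_j\mapsto\alpha\{a_i\mapsto f_{ij}\}_i\}_j\\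 (14)& \alpha(a_i\mapsto\beta(b_j\mapsto f_{ij})_j)_i = \beta(b_j\mapsto\alpha(a_i\mapsto f_{ij})_i)_j\\ (15)& \alpha\{a_i\mapsto\overrightarrow\beta[b_k](f_i)\}_i = \overrightarrow\beta[b_k](\alpha\{a_i\mapsto f_i\}_i)\\ (16)& \overleftarrow\alpha[a_k](\beta(b_i\mapsto g_i)_i) = \beta(b_i\mapsto\overleftarrow\alpha[a_k](g_i))_i\\ (17)& \alpha\{a_i\mapsto\overleftarrow\beta[b_k](f_i)\}_i = \overleftarrow\beta[b_k](\alpha\{a_i\mapsto f_i\}_i)\\ (18)& \overrightarrow\alpha[a_k](\beta(b_i\mapsto g_i)_i) = \beta(b_i\mapsto\overrightarrow\alpha[a_k](g_i))_i\\ (19)& \alpha\{a_i\mapsto\beta(b_j\mapsto f_{ij})_j\}_i = \beta(b_j\mapsto\alpha\{a_i\mapsto f_{ij}\}_i)_j\\ (20)& \overrightarrow\alpha[a_k](\overrightarrow\beta[b_l](f)) = \overrightarrow\beta[b_l](\overrightarrow\alpha[a_k](f))\\ (21)& \overleftarrow\alpha[a_k](\overleftarrow\beta[b_l](f)) = \overleftarrow\beta[b_l](\overleftarrow\alpha[a_k](f))\\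 (22)& \overrightarrow\alpha[a_k](\overleftarrow\beta[b_l](f)) = \overleftarrow\beta[b_l](\overrightarrow\alpha[a_k](f)) \end{array}$$ where $\alpha\neq\beta$ and both sides are terms of the same sequent. The index sets of cotuples and tuples may be empty in all of these rules. Define the **height** of a term by $\mathrm{hgt}[a]=1$ for atomic $a$, $\mathrm{hgt}=1+\max_i\mathrm{hgt}[f_i]$ for a cotuple or tuple of the $f_i$ (with $\max\emptyset=0$), $\mathrm{hgt}=1+\mathrm{hgt}[f]$ for an injection or projection of $f$, and $\mathrm{hgt}[f;_\gamma g]=\mathrm{hgt}[f]+\mathrm{hgt}[g]$. Let $\Lambda(t)$ be the multiset of the heights of all cuts occurring in $t$, and let $>$ be the multiset (Dershowitz–Manna) ordering over $\mathbb N$. Then, for every sequent and all terms $t,u$ of it: 1. (Confluence modulo equations) If $t$ and $u$ are connected by a finite sequence of rewrites, reversed rewrites and permuting conversions, then there are terms $t',u'$ with $t\Rightarrow^*t'$ and $u\Rightarrow^*u'$ such that $t'$ and $u'$ are connected by a finite sequence of permuting conversions alone. 2. If $t\Rightarrow u$, then $\Lambda(t)>\Lambda(u)$. 3. If $u$ arises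 from $t$ by one permuting conversion in whose application all index sets of the cotuples and tuples displayed in the rule are non-empty, then $\Lambda(t)=\Lambda(u)$. -/

import Mathlib

universe u v

namespace SigmaPi

/-! ### Symmetric polycategories, with named wires -/

/-- The two sides of a sequent: a channel (wire) is a domain or a codomain channel. -/
inductive Side where
  | dom
  | cod

instance : Finite Side :=
  Finite.of_injective (fun s : Side => match s with | .dom => true | .cod => false)
    (by intro a b h; cases a <;> cases b <;> simp_all)

/-- Wires labelled by `Γ₁`, with the codomain wire `γ`, are plugged to wires labelled by `Γ₂`, with
the domain wire `δ` of the same object.  All remaining wires, renamed along `e`, are the wires of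
the composite, and these are labelled by `Δ`. -/
def Composable {O : Type u} {V₁ V₂ W : Type} (Γ₁ : V₁ → Side × O) (Γ₂ : V₂ → Side × O)
    (Δ : W → Side × O) (γ : V₁) (δ : V₂) (e : {v // v ≠ γ} ⊕ {v // v ≠ δ} ≃ W) : Prop :=
  (∃ a, Γ₁ γ = (.cod, a) ∧ Γ₂ δ = (.dom, a)) ∧
    (∀ v, Δ (e (.inl v)) = Γ₁ v) ∧ (∀ v, Δ (e (.inr v)) = Γ₂ v)

/-- A symmetric polycategory, in the presentation in which the wires of a polymap are named: the
wires form a finite set `V`, and `Γ : V → Side × Obj` gives the side and the object of every wire.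
The symmetric action is the renaming of wires along a bijection. -/
structure Polycategory where
  Obj : Type u
  Hom : {V : Type} → [Finite V] → (V → Side × Obj) → Type v
  rename : {V W : Type} → [Finite V] → [Finite W] → {Γ : V → Side × Obj} → {Δ : W → Side × Obj} →
    (r : V ≃ W) → (∀ v, Δ (r v) = Γ v) → Hom Γ → Hom Δ
  /-- The identity of `a`, whose two wires are named by their sides. -/
  id : (a : Obj) → Hom (fun s : Side => (s, a))
  cut : {V₁ V₂ W : Type} → [Finite V₁] → [Finite V₂] → [Finite W] →
    {Γ₁ : V₁ → Side × Obj} → {Γ₂ : V₂ → Side × Obj} → {Δ : W → Side × Obj} →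
    (γ : V₁) → (δ : V₂) → (e : {v // v ≠ γ} ⊕ {v // v ≠ δ} ≃ W) →
    Composable Γ₁ Γ₂ Δ γ δ e → Hom Γ₁ → Hom Γ₂ → Hom Δ
  rename_refl : ∀ {V : Type} [Finite V] {Γ : V → Side × Obj} (h) (f : Hom Γ),
    rename (Equiv.refl V) h f = f
  rename_trans : ∀ {V W U : Type} [Finite V] [Finite W] [Finite U]
    {Γ : V → Side × Obj} {Δ : W → Side × Obj} {Θ : U → Side × Obj}
    (r : V ≃ W) (s : W ≃ U) (hr : ∀ v, Δ (r v) = Γ v) (hs : ∀ w, Θ (s w) = Δ w)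
    (hrs : ∀ v, Θ (r.trans s v) = Γ v) (f : Hom Γ),
    rename s hs (rename r hr f) = rename (r.trans s) hrs f
  rename_cut : ∀ {V₁ V₂ W V₁' V₂' W' : Type} [Finite V₁] [Finite V₂] [Finite W]
    [Finite V₁'] [Finite V₂'] [Finite W']
    {Γ₁ : V₁ → Side × Obj} {Γ₂ : V₂ → Side × Obj} {Δ : W → Side × Obj}
    {Γ₁' : V₁' → Side × Obj} {Γ₂' : V₂' → Side × Obj} {Δ' : W' → Side × Obj}
    (γ : V₁) (δ : V₂) (e : {v // v ≠ γ} ⊕ {v // v ≠ δ} ≃ W)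
    (r₁ : V₁ ≃ V₁') (r₂ : V₂ ≃ V₂') (r : W ≃ W')
    (e' : {v // v ≠ r₁ γ} ⊕ {v // v ≠ r₂ δ} ≃ W')
    (h : Composable Γ₁ Γ₂ Δ γ δ e) (h' : Composable Γ₁' Γ₂' Δ' (r₁ γ) (r₂ δ) e')
    (h₁ : ∀ v, Γ₁' (r₁ v) = Γ₁ v) (h₂ : ∀ v, Γ₂' (r₂ v) = Γ₂ v) (hr : ∀ w, Δ' (r w) = Δ w)
    (f : Hom Γ₁) (g : Hom Γ₂),
    (∀ (x : {v // v ≠ γ}) (x' : {v // v ≠ r₁ γ}), x'.1 = r₁ x.1 →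
      r (e (.inl x)) = e' (.inl x')) →
    (∀ (x : {v // v ≠ δ}) (x' : {v // v ≠ r₂ δ}), x'.1 = r₂ x.1 →
      r (e (.inr x)) = e' (.inr x')) →
    rename r hr (cut γ δ e h f g) = cut (r₁ γ) (r₂ δ) e' h' (rename r₁ h₁ f) (rename r₂ h₂ g)
  cut_id : ∀ {V W : Type} [Finite V] [Finite W] {Γ : V → Side × Obj} {Δ : W → Side × Obj}
    (a : Obj) (γ : V) (e : {v // v ≠ γ} ⊕ {s // s ≠ Side.dom} ≃ W)
    (h : Composable Γ (fun s : Side => (s, a)) Δ γ .dom e) (r : V ≃ W)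
    (hr : ∀ v, Δ (r v) = Γ v) (f : Hom Γ),
    (∀ x : {v // v ≠ γ}, r x.1 = e (.inl x)) → (∀ s : {s // s ≠ Side.dom}, r γ = e (.inr s)) →
    cut γ .dom e h f (id a) = rename r hr f
  id_cut : ∀ {V W : Type} [Finite V] [Finite W] {Γ : V → Side × Obj} {Δ : W → Side × Obj}
    (a : Obj) (δ : V) (e : {s // s ≠ Side.cod} ⊕ {v // v ≠ δ} ≃ W)
    (h : Composable (fun s : Side => (s, a)) Γ Δ .cod δ e) (r : V ≃ W)
    (hr : ∀ v, Δ (r v) = Γ v) (f : Hom Γ),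
    (∀ x : {v // v ≠ δ}, r x.1 = e (.inr x)) → (∀ s : {s // s ≠ Side.cod}, r δ = e (.inl s)) →
    cut .cod δ e h (id a) f = rename r hr f
  /-- Associativity: `(f ; g) ; k = f ; (g ; k)`. -/
  assoc : ∀ {V₁ V₂ V₃ W₁₂ W₂₃ W : Type} [Finite V₁] [Finite V₂] [Finite V₃]
    [Finite W₁₂] [Finite W₂₃] [Finite W]
    {Γ₁ : V₁ → Side × Obj} {Γ₂ : V₂ → Side × Obj} {Γ₃ : V₃ → Side × Obj}
    {Δ₁₂ : W₁₂ → Side × Obj} {Δ₂₃ : W₂₃ → Side × Obj} {Δ : W → Side × Obj}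
    (γ : V₁) (δ ε : V₂) (ζ : V₃) (hδ : δ ≠ ε) (hε : ε ≠ δ)
    (e₁₂ : {v // v ≠ γ} ⊕ {v // v ≠ δ} ≃ W₁₂) (e₂₃ : {v // v ≠ ε} ⊕ {v // v ≠ ζ} ≃ W₂₃)
    (e : {w // w ≠ e₁₂ (.inr ⟨ε, hε⟩)} ⊕ {v // v ≠ ζ} ≃ W)
    (e' : {v // v ≠ γ} ⊕ {w // w ≠ e₂₃ (.inl ⟨δ, hδ⟩)} ≃ W)
    (h₁₂ : Composable Γ₁ Γ₂ Δ₁₂ γ δ e₁₂) (h₂₃ : Composable Γ₂ Γ₃ Δ₂₃ ε ζ e₂₃)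
    (h : Composable Δ₁₂ Γ₃ Δ _ ζ e) (h' : Composable Γ₁ Δ₂₃ Δ γ _ e')
    (f : Hom Γ₁) (g : Hom Γ₂) (k : Hom Γ₃),
    (∀ x w, w.1 = e₁₂ (.inl x) → e (.inl w) = e' (.inl x)) →
    (∀ (x : {v // v ≠ δ}) (y : {v // v ≠ ε}) w w', x.1 = y.1 → w.1 = e₁₂ (.inr x) →
      w'.1 = e₂₃ (.inl y) → e (.inl w) = e' (.inr w')) →
    (∀ x w', w'.1 = e₂₃ (.inr x) → e (.inr x) = e' (.inr w')) →
    cut _ ζ e h (cut γ δ e₁₂ h₁₂ f g) k = cut γ _ e' h' f (cut ε ζ e₂₃ h₂₃ g k)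
  /-- Interchange of two cuts on codomain wires of `f`: `(f ; g) ; k = (f ; k) ; g`. -/
  interchange_cod : ∀ {V₁ V₂ V₃ W₁₂ W₁₃ W : Type} [Finite V₁] [Finite V₂] [Finite V₃]
    [Finite W₁₂] [Finite W₁₃] [Finite W]
    {Γ₁ : V₁ → Side × Obj} {Γ₂ : V₂ → Side × Obj} {Γ₃ : V₃ → Side × Obj}
    {Δ₁₂ : W₁₂ → Side × Obj} {Δ₁₃ : W₁₃ → Side × Obj} {Δ : W → Side × Obj}
    (γ ε : V₁) (δ : V₂) (ζ : V₃) (hγ : γ ≠ ε) (hε : ε ≠ γ)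
    (e₁₂ : {v // v ≠ γ} ⊕ {v // v ≠ δ} ≃ W₁₂) (e₁₃ : {v // v ≠ ε} ⊕ {v // v ≠ ζ} ≃ W₁₃)
    (e : {w // w ≠ e₁₂ (.inl ⟨ε, hε⟩)} ⊕ {v // v ≠ ζ} ≃ W)
    (e' : {w // w ≠ e₁₃ (.inl ⟨γ, hγ⟩)} ⊕ {v // v ≠ δ} ≃ W)
    (h₁₂ : Composable Γ₁ Γ₂ Δ₁₂ γ δ e₁₂) (h₁₃ : Composable Γ₁ Γ₃ Δ₁₃ ε ζ e₁₃)
    (h : Composable Δ₁₂ Γ₃ Δ _ ζ e) (h' : Composable Δ₁₃ Γ₂ Δ _ δ e')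
    (f : Hom Γ₁) (g : Hom Γ₂) (k : Hom Γ₃),
    (∀ (x : {v // v ≠ γ}) (y : {v // v ≠ ε}) w w', x.1 = y.1 → w.1 = e₁₂ (.inl x) →
      w'.1 = e₁₃ (.inl y) → e (.inl w) = e' (.inl w')) →
    (∀ x w, w.1 = e₁₂ (.inr x) → e (.inl w) = e' (.inr x)) →
    (∀ x w', w'.1 = e₁₃ (.inr x) → e (.inr x) = e' (.inl w')) →
    cut _ ζ e h (cut γ δ e₁₂ h₁₂ f g) k = cut _ δ e' h' (cut ε ζ e₁₃ h₁₃ f k) g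
  /-- Interchange of two cuts on domain wires of `k`: `f ; (g ; k) = g ; (f ; k)`. -/
  interchange_dom : ∀ {V₁ V₂ V₃ W₁₃ W₂₃ W : Type} [Finite V₁] [Finite V₂] [Finite V₃]
    [Finite W₁₃] [Finite W₂₃] [Finite W]
    {Γ₁ : V₁ → Side × Obj} {Γ₂ : V₂ → Side × Obj} {Γ₃ : V₃ → Side × Obj}
    {Δ₁₃ : W₁₃ → Side × Obj} {Δ₂₃ : W₂₃ → Side × Obj} {Δ : W → Side × Obj}
    (γ : V₁) (ε : V₂) (δ ζ : V₃) (hδ : δ ≠ ζ) (hζ : ζ ≠ δ)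
    (e₁₃ : {v // v ≠ γ} ⊕ {v // v ≠ δ} ≃ W₁₃) (e₂₃ : {v // v ≠ ε} ⊕ {v // v ≠ ζ} ≃ W₂₃)
    (e : {v // v ≠ γ} ⊕ {w // w ≠ e₂₃ (.inr ⟨δ, hδ⟩)} ≃ W)
    (e' : {v // v ≠ ε} ⊕ {w // w ≠ e₁₃ (.inr ⟨ζ, hζ⟩)} ≃ W)
    (h₁₃ : Composable Γ₁ Γ₃ Δ₁₃ γ δ e₁₃) (h₂₃ : Composable Γ₂ Γ₃ Δ₂₃ ε ζ e₂₃)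
    (h : Composable Γ₁ Δ₂₃ Δ γ _ e) (h' : Composable Γ₂ Δ₁₃ Δ ε _ e')
    (f : Hom Γ₁) (g : Hom Γ₂) (k : Hom Γ₃),
    (∀ x w', w'.1 = e₁₃ (.inl x) → e (.inl x) = e' (.inr w')) →
    (∀ x w, w.1 = e₂₃ (.inl x) → e (.inr w) = e' (.inl x)) →
    (∀ (x : {v // v ≠ δ}) (y : {v // v ≠ ζ}) w w', x.1 = y.1 → w'.1 = e₁₃ (.inr x) →
      w.1 = e₂₃ (.inr y) → e (.inr w) = e' (.inr w')) →
    cut γ _ e h f (cut ε ζ e₂₃ h₂₃ g k) = cut ε _ e' h' g (cut γ δ e₁₃ h₁₃ f k)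

/-! ### Formulas and sequents -/

inductive Connective where
  | sum
  | prod

/-- Formulas (protocols): atoms, and finite (possibly empty) sums and products. -/
inductive Formula (O : Type u) : Type u where
  | atom (a : O) : Formula O
  | big (c : Connective) (n : ℕ) (X : Fin n → Formula O) : Formula O

/-- A sequent whose channels have the names `V`: every channel lies in the domain or in the
codomain and carries a formula. -/
abbrev Sequent (O : Type u) (V : Type) : Type u := V → Side × Formula O

/-- The connective on which a process inputs: a sum in the domain, a product in the codomain. -/
def Side.input : Side → Connective
  | .dom => .sum
  | .cod => .prod

/-- The connective on which a process outputs: a product in the domain, a sum in the codomain. -/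
def Side.output : Side → Connective
  | .dom => .prod
  | .cod => .sum

/-- `C'` is the sequent `C` with the formula of the channel `α` replaced by `X`. -/
def IsReplace {O : Type u} {V : Type} (C : Sequent O V) (α : V) (X : Formula O)
    (C' : Sequent O V) : Prop :=
  C' α = ((C α).1, X) ∧ ∀ β, β ≠ α → C' β = C β

theorem IsReplace.rename {O : Type u} {V W : Type} {C : Sequent O V} {α : V} {X : Formula O}
    {C' : Sequent O V} (h : IsReplace C α X C') (r : V ≃ W) {D : Sequent O W}
    (hD : ∀ β, D (r β) = C β) : IsReplace D (r α) X (fun w => C' (r.symm w)) := by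
  refine ⟨by simp [h.1, hD], fun β hβ => ?_⟩
  have := h.2 (r.symm β) (fun e => hβ (by rw [← e, Equiv.apply_symm_apply]))
  simp [this, ← hD]

/-- `C` is the conclusion of a cut on the formula `Z` with premises `C₁` and `C₂`.  The channels in
`S` come from the left premise and all others from the right premise; the cut channel is called
`none` in both premises, and it lies in the codomain of the left and the domain of the right. -/
def IsCut {O : Type u} {V : Type} (C : Sequent O V) (S : Set V) (Z : Formula O)
    (C₁ : Sequent O (Option S)) (C₂ : Sequent O (Option ↥Sᶜ)) : Prop :=
  C₁ none = (.cod, Z) ∧ (∀ α : S, C₁ (some α) = C α) ∧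
    C₂ none = (.dom, Z) ∧ (∀ α : ↥Sᶜ, C₂ (some α) = C α)

/-! ### Terms -/

/-- The terms (derivations) of `C` in the logic over the polycategory `P`.  The channel that is
hidden by a cut is always named `none`, so there is no renaming of bound channels. -/
inductive Term (P : Polycategory.{u, v}) : {V : Type} → Sequent P.Obj V → Type (max 1 u v) where
  /-- A polymap `m` of `P` between atoms (an identity, or another axiom). -/
  | atom {V : Type} [Finite V] {C : Sequent P.Obj V} (A : V → Side × P.Obj) (m : P.Hom A)
      (hC : ∀ α, C α = ((A α).1, .atom (A α).2)) : Term P C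
  /-- The cotuple `α{a_i ↦ f_i}` on a domain channel, the tuple `α(a_i ↦ f_i)` on a codomain
  channel. -/
  | input {V : Type} {C : Sequent P.Obj V} (α : V) (s : Side) (n : ℕ) (X : Fin n → Formula P.Obj)
      (hα : C α = (s, .big s.input n X)) (C' : Fin n → Sequent P.Obj V)
      (hC' : ∀ i, IsReplace C α (X i) (C' i)) (f : ∀ i, Term P (C' i)) : Term P C
  /-- The projection `←α[a_k](f)` on a domain channel, the injection `→α[a_k](f)` on a codomain
  channel. -/
  | output {V : Type} {C : Sequent P.Obj V} (α : V) (s : Side) (n : ℕ) (X : Fin n → Formula P.Obj)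
      (k : Fin n) (hα : C α = (s, .big s.output n X)) (C' : Sequent P.Obj V)
      (hC' : IsReplace C α (X k) C') (f : Term P C') : Term P C
  /-- The cut `f ; g`. -/
  | cut {V : Type} {C : Sequent P.Obj V} (S : Set V) (Z : Formula P.Obj)
      (C₁ : Sequent P.Obj (Option S)) (C₂ : Sequent P.Obj (Option ↥Sᶜ)) (hC : IsCut C S Z C₁ C₂)
      (f : Term P C₁) (g : Term P C₂) : Term P C

namespace Term

variable {P : Polycategory.{u, v}}

/-- The channels coming from one premise of a cut, renamed; the cut channel remains `none`. -/
def cutEquiv {V W : Type} (r : V ≃ W) (S : Set V) (T : Set W) (h : ∀ v, v ∈ S ↔ r v ∈ T) :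
    Option S ≃ Option T :=
  Equiv.optionCongr (r.subtypeEquiv h)

/-- Renaming the free channels of a term along a bijection. -/
def rename : {V W : Type} → {C : Sequent P.Obj V} → (r : V ≃ W) → (D : Sequent P.Obj W) →
    (∀ α, D (r α) = C α) → Term P C → Term P D
  | V, W, _, r, D, h, @Term.atom _ _ hV _ A m hC =>
      haveI : Finite V := hV
      haveI : Finite W := Finite.of_equiv V r
      .atom (fun w => A (r.symm w)) (P.rename r (fun α => by simp) m)
        (fun w => by rw [← hC, ← h, Equiv.apply_symm_apply])
  | _, _, _, r, D, h, .input α s n X hα C' hC' f =>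
      .input (r α) s n X ((h α).trans hα) (fun i w => C' i (r.symm w))
        (fun i => (hC' i).rename r h)
        (fun i => rename r _ (fun β => by simp) (f i))
  | _, _, _, r, D, h, .output α s n X k hα C' hC' f =>
      .output (r α) s n X k ((h α).trans hα) (fun w => C' (r.symm w))
        (hC'.rename r h)
        (rename r _ (fun β => by simp) f)
  | _, _, C, r, D, h, .cut S Z C₁ C₂ hC f g =>
      .cut (r.symm ⁻¹' S) Z
        (fun w => C₁ ((cutEquiv r S (r.symm ⁻¹' S) (fun v => by simp)).symm w))
        (fun w => C₂ ((cutEquiv r Sᶜ (r.symm ⁻¹' S)ᶜ (fun v => by simp)).symm w))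
        ⟨hC.1, fun w => (hC.2.1 _).trans ((h _).symm.trans (congrArg D (r.apply_symm_apply w.1))),
          hC.2.2.1,
          fun w => (hC.2.2.2 _).trans ((h _).symm.trans (congrArg D (r.apply_symm_apply w.1)))⟩
        (rename (cutEquiv r S (r.symm ⁻¹' S) (fun v => by simp)) _ (fun β => by simp) f)
        (rename (cutEquiv r Sᶜ (r.symm ⁻¹' S)ᶜ (fun v => by simp)) _ (fun β => by simp) g)

/-- `t` is the atomic identity `1_a`, with its domain channel and its codomain channel named by
`r`. -/
def IsIdentity {V : Type} {C : Sequent P.Obj V} (t : Term P C) : Prop :=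
  ∃ (_ : Finite V) (a : P.Obj) (r : Side ≃ V) (hC : ∀ α, C α = (r.symm α, .atom a)),
    t = .atom (fun α => (r.symm α, a)) (P.rename r (fun s => by simp) (P.id a)) hC

/-! ### Cut-elimination rewrites and permuting conversions -/

/-- The cut-elimination rewrites at the root of a term.  The cut channel is `none`. -/
inductive Rewrite : {V : Type} → {C : Sequent P.Obj V} → Term P C → Term P C → Prop
  /-- (1): `f ; 1 ⟹ f`, where in `f` the cut channel gets the name of the codomain channel of the
  identity. -/
  | cut_id {V : Type} {C : Sequent P.Obj V} {S : Set V} {Z C₁ C₂} {hC : IsCut C S Z C₁ C₂}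
      {f : Term P C₁} {g : Term P C₂} (r : Option S ≃ V) (hr : ∀ α : S, r (some α) = α)
      (hD : ∀ α, C (r α) = C₁ α) :
      g.IsIdentity → Rewrite (.cut S Z C₁ C₂ hC f g) (f.rename r C hD)
  /-- (2): `1 ; g ⟹ g`. -/
  | id_cut {V : Type} {C : Sequent P.Obj V} {S : Set V} {Z C₁ C₂} {hC : IsCut C S Z C₁ C₂}
      {f : Term P C₁} {g : Term P C₂} (r : Option ↥Sᶜ ≃ V) (hr : ∀ α : ↥Sᶜ, r (some α) = α)
      (hD : ∀ α, C (r α) = C₂ α) :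
      f.IsIdentity → Rewrite (.cut S Z C₁ C₂ hC f g) (g.rename r C hD)
  /-- (3) for `s = dom`: `α{a_i ↦ f_i} ; g ⟹ α{a_i ↦ f_i ; g}`.
  (9) for `s = cod`: `α(a_i ↦ f_i) ; g ⟹ α(a_i ↦ f_i ; g)`. -/
  | input_cut {V : Type} {C : Sequent P.Obj V} {S : Set V} {Z C₁ C₂} {hC : IsCut C S Z C₁ C₂}
      {α : S} {s n X hα C₁' hC₁'} {f : ∀ i, Term P (C₁' i)} {g : Term P C₂} {hα' D hD}
      {hC' : ∀ i, IsCut (D i) S Z (C₁' i) C₂} :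
      Rewrite (C := C) (.cut S Z C₁ C₂ hC (.input (some α) s n X hα C₁' hC₁' f) g)
        (.input α.1 s n X hα' D hD (fun i => .cut S Z (C₁' i) C₂ (hC' i) (f i) g))
  /-- (4) for `s = cod`: `f ; β(b_i ↦ g_i) ⟹ β(b_i ↦ f ; g_i)`.
  (10) for `s = dom`: `f ; β{b_i ↦ g_i} ⟹ β{b_i ↦ f ; g_i}`. -/
  | cut_input {V : Type} {C : Sequent P.Obj V} {S : Set V} {Z C₁ C₂} {hC : IsCut C S Z C₁ C₂}
      {β : ↥Sᶜ} {s n X hβ C₂' hC₂'} {f : Term P C₁} {g : ∀ i, Term P (C₂' i)} {hβ' D hD}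
      {hC' : ∀ i, IsCut (D i) S Z C₁ (C₂' i)} :
      Rewrite (C := C) (.cut S Z C₁ C₂ hC f (.input (some β) s n X hβ C₂' hC₂' g))
        (.input β.1 s n X hβ' D hD (fun i => .cut S Z C₁ (C₂' i) (hC' i) f (g i)))
  /-- (5) for `s = cod`: `→α[a_k](f) ; g ⟹ →α[a_k](f ; g)`.
  (7) for `s = dom`: `←α[a_k](f) ; g ⟹ ←α[a_k](f ; g)`. -/
  | output_cut {V : Type} {C : Sequent P.Obj V} {S : Set V} {Z C₁ C₂} {hC : IsCut C S Z C₁ C₂}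
      {α : S} {s n X k hα C₁' hC₁'} {f : Term P C₁'} {g : Term P C₂} {hα' D hD}
      {hC' : IsCut D S Z C₁' C₂} :
      Rewrite (C := C) (.cut S Z C₁ C₂ hC (.output (some α) s n X k hα C₁' hC₁' f) g)
        (.output α.1 s n X k hα' D hD (.cut S Z C₁' C₂ hC' f g))
  /-- (6) for `s = dom`: `f ; ←β[b_k](g) ⟹ ←β[b_k](f ; g)`.
  (8) for `s = cod`: `f ; →β[b_k](g) ⟹ →β[b_k](f ; g)`. -/
  | cut_output {V : Type} {C : Sequent P.Obj V} {S : Set V} {Z C₁ C₂} {hC : IsCut C S Z C₁ C₂}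
      {β : ↥Sᶜ} {s n X k hβ C₂' hC₂'} {f : Term P C₁} {g : Term P C₂'} {hβ' D hD}
      {hC' : IsCut D S Z C₁ C₂'} :
      Rewrite (C := C) (.cut S Z C₁ C₂ hC f (.output (some β) s n X k hβ C₂' hC₂' g))
        (.output β.1 s n X k hβ' D hD (.cut S Z C₁ C₂' hC' f g))
  /-- (11): `→γ[a_k](f) ;_γ γ{a_i ↦ g_i} ⟹ f ;_γ g_k`. -/
  | injection_cotuple {V : Type} {C : Sequent P.Obj V} {S : Set V} {Z C₁ C₂}
      {hC : IsCut C S Z C₁ C₂} {n X k hγ C₁' hC₁' hγ' C₂' hC₂'}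
      {f : Term P C₁'} {g : ∀ i, Term P (C₂' i)} {hC' : IsCut C S (X k) C₁' (C₂' k)} :
      Rewrite (C := C) (.cut S Z C₁ C₂ hC (.output none .cod n X k hγ C₁' hC₁' f)
          (.input none .dom n X hγ' C₂' hC₂' g))
        (.cut S (X k) C₁' (C₂' k) hC' f (g k))
  /-- (12): `γ(a_i ↦ f_i) ;_γ ←γ[a_k](g) ⟹ f_k ;_γ g`. -/
  | tuple_projection {V : Type} {C : Sequent P.Obj V} {S : Set V} {Z C₁ C₂}
      {hC : IsCut C S Z C₁ C₂} {n X k hγ C₁' hC₁' hγ' C₂' hC₂'}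
      {f : ∀ i, Term P (C₁' i)} {g : Term P C₂'} {hC' : IsCut C S (X k) (C₁' k) C₂'} :
      Rewrite (C := C) (.cut S Z C₁ C₂ hC (.input none .cod n X hγ C₁' hC₁' f)
          (.output none .dom n X k hγ' C₂' hC₂' g))
        (.cut S (X k) (C₁' k) C₂' hC' (f k) g)

/-- The permuting conversions at the root of a term, from left to right, restricted to those whose
cotuples and tuples have index sets of sizes satisfying `ok`. -/
inductive Interchange (ok : ℕ → Prop) :
    {V : Type} → {C : Sequent P.Obj V} → Term P C → Term P C → Prop
  /-- (13) for `s = s' = dom`, (14) for `s = s' = cod`, (19) for `s = dom`, `s' = cod`, and (19)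
  read backwards for `s = cod`, `s' = dom`. -/
  | input_input {V : Type} {C : Sequent P.Obj V} {α β : V} (hne : α ≠ β)
      {s n X s' m Y} (hn : ok n) (hm : ok m)
      {hα C' hC'} {hβ : ∀ i, C' i β = (s', .big s'.input m Y)}
      {C'' : Fin n → Fin m → Sequent P.Obj V}
      {hC'' : ∀ i j, IsReplace (C' i) β (Y j) (C'' i j)} {hβ' D hD}
      {hα' : ∀ j, D j α = (s, .big s.input n X)}
      {hD' : ∀ j i, IsReplace (D j) α (X i) (C'' i j)}
      {f : ∀ i j, Term P (C'' i j)} :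
      Interchange ok (C := C)
        (.input α s n X hα C' hC' fun i => .input β s' m Y (hβ i) (C'' i) (hC'' i) fun j => f i j)
        (.input β s' m Y hβ' D hD fun j =>
          .input α s n X (hα' j) (fun i => C'' i j) (hD' j) fun i => f i j)
  /-- (15) for `s = dom`, `s' = cod`; (16) backwards for `s = cod`, `s' = dom`;
  (17) for `s = s' = dom`; (18) backwards for `s = s' = cod`. -/
  | input_output {V : Type} {C : Sequent P.Obj V} {α β : V} (hne : α ≠ β)
      {s n X s' m Y k} (hn : ok n)
      {hα C' hC'} {hβ : ∀ i, C' i β = (s', .big s'.output m Y)}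
      {C'' : Fin n → Sequent P.Obj V}
      {hC'' : ∀ i, IsReplace (C' i) β (Y k) (C'' i)} {hβ' D hD hα' hD'}
      {f : ∀ i, Term P (C'' i)} :
      Interchange ok (C := C)
        (.input α s n X hα C' hC' fun i => .output β s' m Y k (hβ i) (C'' i) (hC'' i) (f i))
        (.output β s' m Y k hβ' D hD (.input α s n X hα' C'' hD' f))
  /-- (20) for `s = s' = cod`, (21) for `s = s' = dom`, (22) for `s = cod`, `s' = dom`, and (22)
  read backwards for `s = dom`, `s' = cod`. -/
  | output_output {V : Type} {C : Sequent P.Obj V} {α β : V} (hne : α ≠ β)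
      {s n X k s' m Y l hα C' hC' hβ C'' hC'' hβ' D hD hα' hD'} {f : Term P C''} :
      Interchange ok (C := C)
        (.output α s n X k hα C' hC' (.output β s' m Y l hβ C'' hC'' f))
        (.output β s' m Y l hβ' D hD (.output α s n X k hα' C'' hD' f))

/-- One application of `R` somewhere inside a term. -/
inductive Inside (R : ∀ {V : Type} {C : Sequent P.Obj V}, Term P C → Term P C → Prop) :
    {V : Type} → {C : Sequent P.Obj V} → Term P C → Term P C → Prop
  | root {V : Type} {C : Sequent P.Obj V} {t t' : Term P C} : R t t' → Inside R t t'
  | input {V : Type} {C : Sequent P.Obj V} {α : V} {s n X hα C' hC'}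
      {f f' : ∀ i, Term P (C' i)} (i : Fin n) : Inside R (f i) (f' i) →
      (∀ j, j ≠ i → f j = f' j) →
      Inside R (C := C) (.input α s n X hα C' hC' f) (.input α s n X hα C' hC' f')
  | output {V : Type} {C : Sequent P.Obj V} {α : V} {s n X k hα C' hC'} {f f' : Term P C'} :
      Inside R f f' →
      Inside R (C := C) (.output α s n X k hα C' hC' f) (.output α s n X k hα C' hC' f')
  | cut_left {V : Type} {C : Sequent P.Obj V} {S Z C₁ C₂} {hC : IsCut C S Z C₁ C₂}
      {f f' : Term P C₁} {g : Term P C₂} : Inside R f f' →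
      Inside R (.cut S Z C₁ C₂ hC f g) (.cut S Z C₁ C₂ hC f' g)
  | cut_right {V : Type} {C : Sequent P.Obj V} {S Z C₁ C₂} {hC : IsCut C S Z C₁ C₂}
      {f : Term P C₁} {g g' : Term P C₂} : Inside R g g' →
      Inside R (.cut S Z C₁ C₂ hC f g) (.cut S Z C₁ C₂ hC f g')

variable {V : Type} {C : Sequent P.Obj V}

/-- `t ⟹ t'`: one cut-elimination rewrite (1)-(12), anywhere in `t`. -/
def Reduces (t t' : Term P C) : Prop := Inside Rewrite t t'

/-- One permuting conversion (13)-(22), anywhere in `t`, in the direction of `Interchange`. -/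
def Converts (t t' : Term P C) : Prop := Inside (Interchange fun _ => True) t t'

/-- One permuting conversion that does not involve a nullary cotuple or tuple. -/
def ConvertsNonNullary (t t' : Term P C) : Prop := Inside (Interchange fun n => 0 < n) t t'

/-! ### The bag of cut heights -/

/-- The height of a term (the maximum over an empty index set is `0`). -/
def height : {V : Type} → {C : Sequent P.Obj V} → Term P C → ℕ
  | _, _, @Term.atom _ _ _ _ _ _ _ => 1
  | _, _, .input _ _ _ _ _ _ _ f => 1 + Finset.univ.sup fun i => height (f i)
  | _, _, .output _ _ _ _ _ _ _ _ f => 1 + height f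
  | _, _, .cut _ _ _ _ _ f g => height f + height g

/-- The bag of the heights of all cuts in a term. -/
def cutHeights : {V : Type} → {C : Sequent P.Obj V} → Term P C → Multiset ℕ
  | _, _, @Term.atom _ _ _ _ _ _ _ => 0
  | _, _, .input _ _ _ _ _ _ _ f => ∑ i, cutHeights (f i)
  | _, _, .output _ _ _ _ _ _ _ _ f => cutHeights f
  | _, _, .cut _ _ _ _ _ f g => (height f + height g) ::ₘ (cutHeights f + cutHeights g)

end Term

end SigmaPi

namespace SigmaPi

namespace Term

variable {P : Polycategory.{u, v}}

/-! ### Renaming -/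

/-! Confluence is proved by evaluation, not by termination together with critical pairs. Each term
`t` gets a specific reduct `eval t`, computed by eliminating innermost cuts with one fixed strategy
(`normalCut`), so `t ⟹* eval t` holds by construction. It then suffices that every rewrite and every
conversion `t → u` leaves `eval t` and `eval u` connected by conversions: along any zigzag from `t`
to `u` the evaluations stay connected, and `eval t`, `eval u` are the required reducts.

At the root of a term, most rewrites are literally the defining equations of `normalCut`. Three
points need an argument. First, the strategy inspects the left premise of a cut before the right
one; pulling an operation out of the right premise nevertheless agrees with it up to conversions
(`normalCut_input_right`, `normalCut_output_right`), since operations coming from different premises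
act on different channels and can be interchanged. Secondly, a cut with an identity evaluates to a
renaming (`normalCut_identity_left`, `normalCut_identity_right`), and evaluation commutes with
renaming (`normalCut_rename`). Thirdly, for steps inside a cut, `normalCut` must respect conversions
in either premise (`normalCut_equivalent_left`, `normalCut_equivalent_right`): a conversion of
operations on free channels reappears outside the cut, while an operation on the cut channel is
cancelled by its dual in the other premise. Polymaps are never composed by the rewrites, so
evaluated terms are inputs and outputs over trees of cuts of polymaps (`Normal`).

For the multiset claims, a rewrite replaces a cut of height `h` by cuts of height below `h`, and
whatever cuts it copies also lie below `h`. Rewrites do not increase the height of a term, so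
enclosing cuts do no harm. Conversions permute the cuts, and preserve heights when no index set is
empty. -/

theorem cut_heq {V : Type} {C : Sequent P.Obj V} {S : Set V} {Z : Formula P.Obj}
    {C₁ C₁' : Sequent P.Obj (Option S)} {C₂ C₂' : Sequent P.Obj (Option ↥Sᶜ)}
    {hC : IsCut C S Z C₁ C₂} {hC' : IsCut C S Z C₁' C₂'}
    {f : Term P C₁} {g : Term P C₂} {f' : Term P C₁'} {g' : Term P C₂'}
    (h₁ : C₁ = C₁') (h₂ : C₂ = C₂') (hf : HEq f f') (hg : HEq g g') :
    Term.cut S Z C₁ C₂ hC f g = Term.cut S Z C₁' C₂' hC' f' g' := by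
  subst h₁ h₂
  rw [eq_of_heq hf, eq_of_heq hg]

/-- Renaming a cut changes the index types of its premises. The resulting bijections and sequents
agree only propositionally, whence heterogeneous equality here and in `cut_heq`. -/
theorem rename_heq {V W : Type} {C : Sequent P.Obj V} {r r' : V ≃ W} {D D' : Sequent P.Obj W}
    (hr : r = r') (hD : D = D') (h : ∀ α, D (r α) = C α) (h' : ∀ α, D' (r' α) = C α)
    (t : Term P C) : HEq (t.rename r D h) (t.rename r' D' h') := by
  subst hr hD
  rfl

theorem cutEquiv_trans {V W U : Type} (r : V ≃ W) (s : W ≃ U) (S : Set V) (T : Set W) (R : Set U)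
    (hr : ∀ v, v ∈ S ↔ r v ∈ T) (hs : ∀ w, w ∈ T ↔ s w ∈ R)
    (hrs : ∀ v, v ∈ S ↔ (r.trans s) v ∈ R) :
    (cutEquiv r S T hr).trans (cutEquiv s T R hs) = cutEquiv (r.trans s) S R hrs := by
  ext x
  cases x <;> simp [cutEquiv]

theorem cutEquiv_refl {V : Type} (S : Set V) (h : ∀ v, v ∈ S ↔ (Equiv.refl V) v ∈ S) :
    cutEquiv (Equiv.refl V) S S h = Equiv.refl (Option S) := by
  ext x
  cases x <;> simp [cutEquiv]

theorem rename_trans {V W U : Type} {C : Sequent P.Obj V} (t : Term P C) (r : V ≃ W) (s : W ≃ U)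
    {D : Sequent P.Obj W} {E : Sequent P.Obj U} (hr : ∀ α, D (r α) = C α)
    (hs : ∀ α, E (s α) = D α) :
    (t.rename r D hr).rename s E hs
      = t.rename (r.trans s) E (fun α => (hs _).trans (hr α)) := by
  induction t generalizing W U with
  | atom A m hC =>
    have := Finite.of_equiv _ r
    have := Finite.of_equiv _ s
    simp only [rename]
    congr 1
    exact P.rename_trans _ _ _ _ _ _
  | input α s' n X hα C' hC' f ih =>
    simp only [rename, ih]
    rfl
  | output α s' n X k hα C' hC' f ih =>
    simp only [rename, ih]
    rfl
  | cut S Z C₁ C₂ hC f g ihf ihg =>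
    simp only [rename, ihf, ihg]
    -- The iterated preimage of `S` is definitionally the preimage under the composite, so the two
    -- cuts already share their channel set.
    have e₁ := cutEquiv_trans r s S (r.symm ⁻¹' S) (s.symm ⁻¹' (r.symm ⁻¹' S))
      (by simp) (by simp) (by simp)
    have e₂ := cutEquiv_trans r s Sᶜ (r.symm ⁻¹' S)ᶜ (s.symm ⁻¹' (r.symm ⁻¹' S))ᶜ
      (by simp) (by simp) (by simp)
    refine cut_heq ?_ ?_ ?_ ?_
    · exact congrArg (fun e : Option S ≃ _ => fun w => C₁ (e.symm w)) e₁
    · exact congrArg (fun e : Option ↥Sᶜ ≃ _ => fun w => C₂ (e.symm w)) e₂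
    · exact rename_heq e₁ (congrArg (fun e : Option S ≃ _ => fun w => C₁ (e.symm w)) e₁) _ _ _
    · exact rename_heq e₂ (congrArg (fun e : Option ↥Sᶜ ≃ _ => fun w => C₂ (e.symm w)) e₂) _ _ _

theorem rename_refl {V : Type} {C : Sequent P.Obj V} (t : Term P C)
    (h : ∀ α, C (Equiv.refl V α) = C α) : t.rename (Equiv.refl V) C h = t := by
  induction t with
  | atom A m hC =>
    simp only [rename]
    congr 1
    exact P.rename_refl _ _
  | input α s' n X hα C' hC' f ih =>
    simp only [rename]
    congr 1
    funext i
    exact ih i _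
  | output α s' n X k hα C' hC' f ih =>
    simp only [rename]
    congr 1
    exact ih _
  | cut S Z C₁ C₂ hC f g ihf ihg =>
    simp only [rename]
    have e₁ := cutEquiv_refl S (by simp)
    have e₂ := cutEquiv_refl Sᶜ (by simp)
    have d₁ := congrArg (fun e : Option S ≃ _ => fun w => C₁ (e.symm w)) e₁
    have d₂ := congrArg (fun e : Option ↥Sᶜ ≃ _ => fun w => C₂ (e.symm w)) e₂
    refine cut_heq d₁ d₂ ?_ ?_
    · exact (rename_heq e₁ d₁ _ (fun _ => rfl) f).trans (heq_of_eq (ihf _))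
    · exact (rename_heq e₂ d₂ _ (fun _ => rfl) g).trans (heq_of_eq (ihg _))

theorem IsIdentity.rename {V W : Type} {C : Sequent P.Obj V} {t : Term P C} (ht : t.IsIdentity)
    (r : V ≃ W) (D : Sequent P.Obj W) (h : ∀ α, D (r α) = C α) : (t.rename r D h).IsIdentity := by
  obtain ⟨hV, a, e, hC, rfl⟩ := ht
  refine ⟨Finite.of_equiv V r, a, e.trans r, fun w => ?_, ?_⟩
  · rw [← r.apply_symm_apply w, h, hC]
    simp
  · have := Finite.of_equiv _ r
    simp only [Term.rename]
    congr 1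
    exact P.rename_trans _ _ _ _ _ _

theorem isIdentity_rename {V W : Type} {C : Sequent P.Obj V} {t : Term P C}
    (r : V ≃ W) (D : Sequent P.Obj W) (h : ∀ α, D (r α) = C α) :
    (t.rename r D h).IsIdentity ↔ t.IsIdentity := by
  refine ⟨fun ht => ?_, fun ht => ht.rename r D h⟩
  have := ht.rename r.symm C (fun w => by rw [← h, Equiv.apply_symm_apply])
  -- Stated for a variable `s` so that its equality with the identity can be substituted in the
  -- dependent proof argument.
  have e : ∀ (s : V ≃ V) (hs : ∀ α, C (s α) = C α), s = Equiv.refl V → t.rename s C hs = t := by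
    rintro _ hs rfl
    exact rename_refl t hs
  exact ((rename_trans t r r.symm h _).trans (e _ _ (Equiv.self_trans_symm r))) ▸ this

theorem height_rename {V W : Type} {C : Sequent P.Obj V} (t : Term P C) (r : V ≃ W)
    (D : Sequent P.Obj W) (h : ∀ α, D (r α) = C α) : (t.rename r D h).height = t.height := by
  induction t generalizing W with
  | atom A m hC => rfl
  | input α s' n X hα C' hC' f ih => simp only [rename, height, ih]
  | output α s' n X k hα C' hC' f ih => simp only [rename, height, ih]
  | cut S Z C₁ C₂ hC f g ihf ihg => simp only [rename, height, ihf, ihg]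

theorem cutHeights_rename {V W : Type} {C : Sequent P.Obj V} (t : Term P C) (r : V ≃ W)
    (D : Sequent P.Obj W) (h : ∀ α, D (r α) = C α) :
    (t.rename r D h).cutHeights = t.cutHeights := by
  induction t generalizing W with
  | atom A m hC => rfl
  | input α s' n X hα C' hC' f ih => simp only [rename, cutHeights, ih]
  | output α s' n X k hα C' hC' f ih => simp only [rename, cutHeights, ih]
  | cut S Z C₁ C₂ hC f g ihf ihg => simp only [rename, cutHeights, height_rename, ihf, ihg]

/-! ### Heights of terms and of cuts -/

/-- The height of a cut equals its height as a term, and height is monotone along subterms. This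
bounds the cuts that are copied when a premise is duplicated. -/
theorem le_height_of_mem_cutHeights {V : Type} {C : Sequent P.Obj V} (t : Term P C) :
    ∀ x ∈ t.cutHeights, x ≤ t.height := by
  induction t with
  | atom A m hC => simp [cutHeights]
  | input α s' n X hα C' hC' f ih =>
    intro x hx
    simp only [cutHeights, Multiset.mem_sum, Finset.mem_univ, true_and] at hx
    obtain ⟨i, hi⟩ := hx
    simp only [height]
    exact (ih i x hi).trans ((Finset.le_sup (f := fun i => height (f i)) (Finset.mem_univ i)).trans
      (Nat.le_add_left _ _))
  | output α s' n X k hα C' hC' f ih =>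
    intro x hx
    have := ih x hx
    simp only [height]
    omega
  | cut S Z C₁ C₂ hC f g ihf ihg =>
    intro x hx
    simp only [cutHeights, Multiset.mem_cons, Multiset.mem_add] at hx
    simp only [height]
    rcases hx with rfl | hx | hx
    · exact le_rfl
    · exact (ihf x hx).trans (Nat.le_add_right _ _)
    · exact (ihg x hx).trans (Nat.le_add_left _ _)

theorem height_lt_input {n : ℕ} {V : Type} {C : Fin n → Sequent P.Obj V} (f : ∀ i, Term P (C i))
    (i : Fin n) : height (f i) < 1 + Finset.univ.sup fun i => height (f i) := by
  have := Finset.le_sup (f := fun i => height (f i)) (Finset.mem_univ i)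
  omega

/-- For a commuted input this is `max (h_i + c) ≤ max h_i + c`, strict when the index set is empty.
It controls the cuts that enclose a rewritten subterm. -/
theorem Rewrite.height_le {V : Type} {C : Sequent P.Obj V} {t t' : Term P C} (h : Rewrite t t') :
    t'.height ≤ t.height := by
  cases h with
  | cut_id => simp only [height, height_rename]; omega
  | id_cut => simp only [height, height_rename]; omega
  | @input_cut _ _ _ _ _ _ _ _ _ _ _ _ f g =>
    simp only [height, add_assoc]
    refine Nat.add_le_add_left (Finset.sup_le fun i _ => ?_) _
    exact Nat.add_le_add_right (Finset.le_sup (f := fun i => height (f i)) (Finset.mem_univ i)) _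
  | @cut_input _ _ _ _ _ _ _ _ _ _ _ _ f g =>
    simp only [height]
    rw [add_left_comm]
    refine Nat.add_le_add_left (Finset.sup_le fun i _ => ?_) _
    exact Nat.add_le_add_left (Finset.le_sup (f := fun i => height (g i)) (Finset.mem_univ i)) _
  | output_cut => simp only [height]; omega
  | cut_output => simp only [height]; omega
  | @injection_cotuple _ _ _ _ _ _ _ k _ _ _ _ _ _ f g =>
    have := height_lt_input g k
    simp only [height]
    omega
  | @tuple_projection _ _ _ _ _ _ _ k _ _ _ _ _ _ f g =>
    have := height_lt_input f k
    simp only [height]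
    omega

theorem Reduces.height_le {V : Type} {C : Sequent P.Obj V} {t t' : Term P C} (h : Reduces t t') :
    t'.height ≤ t.height := by
  unfold Reduces at h
  induction h with
  | root h => exact h.height_le
  | @input _ _ _ _ _ _ _ _ _ f f' i hi hne ih =>
    simp only [height]
    refine Nat.add_le_add_left (Finset.sup_mono_fun fun j _ => ?_) _
    by_cases hj : j = i
    · exact hj ▸ ih
    · rw [hne j hj]
  | output _ ih => simp only [height]; omega
  | cut_left _ ih => simp only [height]; omega
  | cut_right _ ih => simp only [height]; omega

/-! ### Rewrites and the multiset ordering -/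

/-- The part `W` allows the cuts of a duplicated premise to be discarded with the rewritten cut and
all their copies to be counted among the new elements `Y`; an empty index set then needs no separate
treatment. -/
theorem isDershowitzMannaLT_add_cons {h : ℕ} {X Y W : Multiset ℕ} (hY : ∀ y ∈ Y, y < h) :
    Multiset.IsDershowitzMannaLT (X + Y) (X + h ::ₘ W) :=
  ⟨X, Y, h ::ₘ W, by simp, rfl, rfl, fun y hy => ⟨h, by simp, hY y hy⟩⟩

theorem isDershowitzMannaLT_add_right {M N : Multiset ℕ} (h : Multiset.IsDershowitzMannaLT M N)
    (K : Multiset ℕ) : Multiset.IsDershowitzMannaLT (M + K) (N + K) := by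
  obtain ⟨X, Y, Z, hZ, rfl, rfl, hYZ⟩ := h
  exact ⟨X + K, Y, Z, hZ, by abel, by abel, hYZ⟩

/-- Serves for an enclosing cut: its own height either stays, and joins the common part, or drops,
and is dominated by its former value. -/
theorem isDershowitzMannaLT_cons {M N : Multiset ℕ} (h : Multiset.IsDershowitzMannaLT M N)
    {a b : ℕ} (hab : a ≤ b) : Multiset.IsDershowitzMannaLT (a ::ₘ M) (b ::ₘ N) := by
  obtain ⟨X, Y, Z, hZ, rfl, rfl, hYZ⟩ := h
  rcases hab.eq_or_lt with rfl | hlt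
  · exact ⟨a ::ₘ X, Y, Z, hZ, by simp, by simp, hYZ⟩
  · refine ⟨X, a ::ₘ Y, b ::ₘ Z, by simp, by simp, by simp, fun y hy => ?_⟩
    rcases Multiset.mem_cons.1 hy with rfl | hy
    · exact ⟨b, by simp, hlt⟩
    · obtain ⟨z, hz, hlt⟩ := hYZ y hy
      exact ⟨z, by simp [hz], hlt⟩

theorem Rewrite.cutHeights_lt {V : Type} {C : Sequent P.Obj V} {t t' : Term P C}
    (h : Rewrite t t') : Multiset.IsDershowitzMannaLT t'.cutHeights t.cutHeights := by
  cases h with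
  | @cut_id _ _ _ _ _ f g =>
    simp only [cutHeights, cutHeights_rename]
    rw [← Multiset.add_cons]
    simpa using isDershowitzMannaLT_add_cons (X := f.cutHeights) (Y := 0)
      (W := g.cutHeights) (h := f.height + g.height) (by simp)
  | @id_cut _ _ _ _ _ f g =>
    simp only [cutHeights, cutHeights_rename]
    rw [add_comm f.cutHeights, ← Multiset.add_cons]
    simpa using isDershowitzMannaLT_add_cons (X := g.cutHeights) (Y := 0)
      (W := f.cutHeights) (h := f.height + g.height) (by simp)
  | @input_cut _ _ _ _ _ _ _ _ _ _ _ _ f g =>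
    simp only [cutHeights, height]
    rw [← Multiset.add_cons]
    -- The cuts of the `f i` survive unchanged. The new cuts and the copies of the cuts of `g` are
    -- all lower than the original cut, because `height g < 1 + … + height g`.
    have e : ∑ i, ((height (f i) + height g) ::ₘ (cutHeights (f i) + cutHeights g)) =
        ∑ i, cutHeights (f i) + ∑ i, ((height (f i) + height g) ::ₘ cutHeights g) := by
      rw [← Finset.sum_add_distrib]
      simp
    rw [e]
    refine isDershowitzMannaLT_add_cons fun y hy => ?_
    simp only [Multiset.mem_sum, Finset.mem_univ, true_and, Multiset.mem_cons] at hy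
    obtain ⟨i, hi⟩ := hy
    have := height_lt_input f i
    rcases hi with rfl | hi
    · omega
    · have := le_height_of_mem_cutHeights g y hi
      omega
  | @cut_input _ _ _ _ _ _ _ _ _ _ _ _ f g =>
    simp only [cutHeights, height]
    rw [add_comm f.cutHeights, ← Multiset.add_cons]
    have e : ∑ i, ((height f + height (g i)) ::ₘ (cutHeights f + cutHeights (g i))) =
        ∑ i, cutHeights (g i) + ∑ i, ((height f + height (g i)) ::ₘ cutHeights f) := by
      rw [← Finset.sum_add_distrib]
      simp [add_comm]
    rw [e]
    refine isDershowitzMannaLT_add_cons fun y hy => ?_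
    simp only [Multiset.mem_sum, Finset.mem_univ, true_and, Multiset.mem_cons] at hy
    obtain ⟨i, hi⟩ := hy
    have := height_lt_input g i
    rcases hi with rfl | hi
    · omega
    · have := le_height_of_mem_cutHeights f y hi
      omega
  | @output_cut _ _ _ _ _ _ _ _ _ _ _ _ _ f g =>
    simp only [cutHeights, height]
    have := isDershowitzMannaLT_add_cons (X := f.cutHeights + g.cutHeights)
      (Y := {f.height + g.height}) (W := 0) (h := 1 + f.height + g.height)
      (by intro y hy; rw [Multiset.mem_singleton.1 hy]; omega)
    rwa [← Multiset.singleton_add, ← Multiset.singleton_add, add_comm {_}, add_comm {_}]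
  | @cut_output _ _ _ _ _ _ _ _ _ _ _ _ _ f g =>
    simp only [cutHeights, height]
    have := isDershowitzMannaLT_add_cons (X := f.cutHeights + g.cutHeights)
      (Y := {f.height + g.height}) (W := 0) (h := f.height + (1 + g.height))
      (by intro y hy; rw [Multiset.mem_singleton.1 hy]; omega)
    rwa [← Multiset.singleton_add, ← Multiset.singleton_add, add_comm {_}, add_comm {_}]
  | @injection_cotuple _ _ _ _ _ _ _ k _ _ _ _ _ _ f g =>
    simp only [cutHeights, height]
    rw [← Multiset.add_cons, ← Multiset.add_cons]
    refine isDershowitzMannaLT_add_cons fun y hy => ?_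
    have := height_lt_input g k
    rcases Multiset.mem_cons.1 hy with rfl | hy
    · omega
    · have := le_height_of_mem_cutHeights _ y hy
      omega
  | @tuple_projection _ _ _ _ _ _ _ k _ _ _ _ _ _ f g =>
    simp only [cutHeights, height]
    rw [add_comm (cutHeights _), add_comm (∑ i, _), ← Multiset.add_cons, ← Multiset.add_cons]
    refine isDershowitzMannaLT_add_cons fun y hy => ?_
    have := height_lt_input f k
    rcases Multiset.mem_cons.1 hy with rfl | hy
    · omega
    · have := le_height_of_mem_cutHeights _ y hy
      omega

theorem Reduces.cutHeights_lt {V : Type} {C : Sequent P.Obj V} {t t' : Term P C}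
    (h : Reduces t t') : Multiset.IsDershowitzMannaLT t'.cutHeights t.cutHeights := by
  unfold Reduces at h
  induction h with
  | root h => exact h.cutHeights_lt
  | @input _ _ _ _ _ _ _ _ _ f f' i hi hne ih =>
    simp only [cutHeights]
    rw [← Finset.add_sum_erase _ _ (Finset.mem_univ i),
      ← Finset.add_sum_erase _ (fun i => cutHeights (f i)) (Finset.mem_univ i),
      Finset.sum_congr rfl fun j hj => by rw [← hne j (Finset.ne_of_mem_erase hj)]]
    exact isDershowitzMannaLT_add_right ih _
  | output _ ih => simpa only [cutHeights] using ih
  | cut_left h ih =>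
    simp only [cutHeights]
    exact isDershowitzMannaLT_cons (isDershowitzMannaLT_add_right ih _)
      (Nat.add_le_add_right (Reduces.height_le h) _)
  | @cut_right _ _ _ _ _ _ _ f _ _ h ih =>
    simp only [cutHeights]
    rw [add_comm (cutHeights f), add_comm (cutHeights f)]
    exact isDershowitzMannaLT_cons (isDershowitzMannaLT_add_right ih _)
      (Nat.add_le_add_left (Reduces.height_le h) _)

/-! ### Conversions and heights -/

/-- For `n = 0` the left side is `0` and the right side is `1`: this is the point at which nullary
conversions change heights. -/
theorem sup_one_add {n : ℕ} (hn : 0 < n) (f : Fin n → ℕ) :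
    (Finset.univ.sup fun i => 1 + f i) = 1 + Finset.univ.sup f := by
  have : Nonempty (Fin n) := ⟨⟨0, hn⟩⟩
  exact (Finset.apply_sup_eq_sup_comp_of_nonempty (g := fun x => 1 + x)
    (fun a b h => Nat.add_le_add_left h 1) Finset.univ_nonempty).symm

theorem Interchange.height_eq {V : Type} {C : Sequent P.Obj V} {t t' : Term P C}
    (h : Interchange (fun n => 0 < n) t t') : t.height = t'.height := by
  cases h with
  | input_input _ hn hm =>
    simp only [height]
    rw [sup_one_add hn, sup_one_add hm, Finset.sup_comm]
  | input_output _ hn =>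
    simp only [height]
    rw [sup_one_add hn]
  | output_output => simp only [height]

/-- At the root, empty index sets are harmless: either both sides contain the same cuts or both
contain none. Non-emptiness matters only for the heights of enclosing cuts. -/
theorem Interchange.cutHeights_eq {ok : ℕ → Prop} {V : Type} {C : Sequent P.Obj V}
    {t t' : Term P C} (h : Interchange ok t t') : t.cutHeights = t'.cutHeights := by
  cases h with
  | input_input => simp only [cutHeights]; exact Finset.sum_comm
  | input_output => simp only [cutHeights]
  | output_output => simp only [cutHeights]

theorem ConvertsNonNullary.heights_eq {V : Type} {C : Sequent P.Obj V} {t t' : Term P C}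
    (h : ConvertsNonNullary t t') : t.height = t'.height ∧ t.cutHeights = t'.cutHeights := by
  unfold ConvertsNonNullary at h
  induction h with
  | root h => exact ⟨h.height_eq, h.cutHeights_eq⟩
  | @input _ _ _ _ _ _ _ _ _ f f' i hi hne ih =>
    have : ∀ j, (f j).height = (f' j).height ∧ (f j).cutHeights = (f' j).cutHeights := by
      intro j
      by_cases hj : j = i
      · exact hj ▸ ih
      · rw [hne j hj]
        exact ⟨rfl, rfl⟩
    simp only [height, cutHeights, this, and_self]
  | output _ ih => simp only [height, cutHeights, ih, and_self]
  | cut_left _ ih => simp only [height, cutHeights, ih, and_self]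
  | cut_right _ ih => simp only [height, cutHeights, ih, and_self]

end Term

end SigmaPi

namespace SigmaPi

/-! ### Sequents with a replaced channel -/

/-- Premise sequents in the rules are arbitrary subject to `IsReplace`; uniqueness lets them be
exchanged for the canonical `replace`. -/
theorem IsReplace.unique {O : Type u} {V : Type} {C : Sequent O V} {α : V} {X : Formula O}
    {D D' : Sequent O V} (h : IsReplace C α X D) (h' : IsReplace C α X D') : D = D' := by
  funext β
  by_cases hβ : β = α
  · rw [hβ, h.1, h'.1]
  · rw [h.2 β hβ, h'.2 β hβ]

theorem IsReplace.swap {O : Type u} {V : Type} {C : Sequent O V} {α β : V} {X Y : Formula O}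
    {D D' E : Sequent O V} (hne : α ≠ β) (h : IsReplace C α X D) (hE : IsReplace D β Y E)
    (h' : IsReplace C β Y D') : IsReplace D' α X E := by
  refine ⟨by rw [hE.2 α hne, h.1, h'.2 α hne], fun γ hγ => ?_⟩
  by_cases hγβ : γ = β
  · rw [hγβ, hE.1, h'.1, h.2 β hne.symm]
  · rw [hE.2 γ hγβ, h.2 γ hγ, h'.2 γ hγβ]

open Classical in
/-- The sequent `C` with the formula of the channel `α` replaced by `X`. -/
noncomputable def replace {O : Type u} {V : Type} (C : Sequent O V) (α : V) (X : Formula O) :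
    Sequent O V :=
  Function.update C α ((C α).1, X)

theorem isReplace_replace {O : Type u} {V : Type} (C : Sequent O V) (α : V) (X : Formula O) :
    IsReplace C α X (replace C α X) :=
  ⟨by simp [replace], fun β hβ => by simp [replace, hβ]⟩

/-- Phrased with `Fin.cast` so that `normalCut` can select a branch when the two cut formulas are
only propositionally equal. -/
theorem Formula.big_inj {O : Type u} {c c' : Connective} {n m : ℕ} {X : Fin n → Formula O}
    {Y : Fin m → Formula O} (h : Formula.big c n X = Formula.big c' m Y) :
    ∃ e : m = n, ∀ k, X (Fin.cast e k) = Y k := by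
  cases h
  exact ⟨rfl, fun _ => rfl⟩

namespace IsCut

variable {O : Type u} {V : Type} {C : Sequent O V} {S : Set V} {Z : Formula O}
  {C₁ : Sequent O (Option S)} {C₂ : Sequent O (Option ↥Sᶜ)}

theorem replace_left (hC : IsCut C S Z C₁ C₂) {α : S} {X : Formula O} {C₁' : Sequent O (Option S)}
    {D : Sequent O V} (h : IsReplace C₁ (some α) X C₁') (hD : IsReplace C α X D) :
    IsCut D S Z C₁' C₂ := by
  refine ⟨(h.2 _ (by simp)).trans hC.1, fun β => ?_, hC.2.2.1, fun β => ?_⟩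
  · by_cases hβ : β = α
    · rw [hβ, h.1, hD.1, hC.2.1]
    · rw [h.2 _ (by simpa using hβ), hD.2 _ (fun e => hβ (Subtype.ext e)), hC.2.1]
  · rw [hD.2 _ (fun e => β.2 ((congrArg (· ∈ S) e).mpr α.2)), hC.2.2.2]

theorem replace_right (hC : IsCut C S Z C₁ C₂) {β : ↥Sᶜ} {X : Formula O}
    {C₂' : Sequent O (Option ↥Sᶜ)} {D : Sequent O V} (h : IsReplace C₂ (some β) X C₂')
    (hD : IsReplace C β X D) : IsCut D S Z C₁ C₂' := by
  refine ⟨hC.1, fun α => ?_, (h.2 _ (by simp)).trans hC.2.2.1, fun α => ?_⟩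
  · rw [hD.2 _ (fun e => β.2 (e ▸ α.2)), hC.2.1]
  · by_cases hβ : α = β
    · rw [hβ, h.1, hD.1, hC.2.2.2]
    · rw [h.2 _ (by simpa using hβ), hD.2 _ (fun e => hβ (Subtype.ext e)), hC.2.2.2]

theorem replace_none (hC : IsCut C S Z C₁ C₂) {X : Formula O} {C₁' : Sequent O (Option S)}
    {C₂' : Sequent O (Option ↥Sᶜ)} (h₁ : IsReplace C₁ none X C₁') (h₂ : IsReplace C₂ none X C₂') :
    IsCut C S X C₁' C₂' :=
  ⟨by rw [h₁.1, hC.1], fun α => by rw [h₁.2 _ (by simp), hC.2.1], by rw [h₂.1, hC.2.2.1],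
    fun α => by rw [h₂.2 _ (by simp), hC.2.2.2]⟩

theorem left_none (hC : IsCut C S Z C₁ C₂) {s : Side} {X : Formula O} (h : C₁ none = (s, X)) :
    s = .cod ∧ Z = X := by
  have := hC.1.symm.trans h
  simp only [Prod.mk.injEq] at this
  exact ⟨this.1.symm, this.2⟩

theorem right_none (hC : IsCut C S Z C₁ C₂) {s : Side} {X : Formula O} (h : C₂ none = (s, X)) :
    s = .dom ∧ Z = X := by
  have := hC.2.2.1.symm.trans h
  simp only [Prod.mk.injEq] at this
  exact ⟨this.1.symm, this.2⟩

end IsCut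

/-! ### A fixed strategy for eliminating one cut -/

namespace Term

variable {P : Polycategory.{u, v}}

/-- `r` fixes the channels in `S`, and the cut channel gets the name of the remaining channel of
`C`. -/
def FillsNone {V : Type} {S : Set V} (C : Sequent P.Obj V) (C₁ : Sequent P.Obj (Option S))
    (r : Option S ≃ V) : Prop :=
  (∀ α : S, r (some α) = α) ∧ ∀ α, C (r α) = C₁ α

open Classical in
/-- The cut of two terms none of whose channels but the cut channel can be dealt with first. -/
noncomputable def leafCut {V : Type} {C : Sequent P.Obj V} {S : Set V} {Z : Formula P.Obj}
    {C₁ : Sequent P.Obj (Option S)} {C₂ : Sequent P.Obj (Option ↥Sᶜ)} (hC : IsCut C S Z C₁ C₂)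
    (f : Term P C₁) (g : Term P C₂) : Term P C :=
  -- The bijection is part of the condition, so its existence need not be derived from the identity;
  -- the identity rewrites supply one.
  if h : f.IsIdentity ∧ ∃ r : Option ↥Sᶜ ≃ V, FillsNone C C₂ r then
    g.rename h.2.choose C h.2.choose_spec.2
  else if h : g.IsIdentity ∧ ∃ r : Option S ≃ V, FillsNone C C₁ r then
    f.rename h.2.choose C h.2.choose_spec.2
  else .cut S Z C₁ C₂ hC f g

/-- Cut elimination for a cut of cut-free terms. -/
noncomputable def normalCut {V : Type} {C : Sequent P.Obj V} {S : Set V} {Z : Formula P.Obj}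
    {C₁ : Sequent P.Obj (Option S)} {C₂ : Sequent P.Obj (Option ↥Sᶜ)} (hC : IsCut C S Z C₁ C₂)
    (f : Term P C₁) (g : Term P C₂) : Term P C :=
  match f, g with
  -- Earlier patterns take precedence, so free operations of the left premise come out before those
  -- of the right. This bias makes the result a function.
  | .input (some α) s n X hα C₁' hC₁' f, g =>
    .input α.1 s n X ((hC.2.1 α).symm.trans hα) (fun i => replace C α (X i))
      (fun i => isReplace_replace C α (X i))
      (fun i => normalCut (hC.replace_left (hC₁' i) (isReplace_replace C α (X i))) (f i) g)
  | .output (some α) s n X k hα C₁' hC₁' f, g =>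
    .output α.1 s n X k ((hC.2.1 α).symm.trans hα) (replace C α (X k)) (isReplace_replace C α (X k))
      (normalCut (hC.replace_left hC₁' (isReplace_replace C α (X k))) f g)
  | f, .input (some β) s n X hβ C₂' hC₂' g =>
    .input β.1 s n X ((hC.2.2.2 β).symm.trans hβ) (fun i => replace C β (X i))
      (fun i => isReplace_replace C β (X i))
      (fun i => normalCut (hC.replace_right (hC₂' i) (isReplace_replace C β (X i))) f (g i))
  | f, .output (some β) s n X k hβ C₂' hC₂' g =>
    .output β.1 s n X k ((hC.2.2.2 β).symm.trans hβ) (replace C β (X k)) (isReplace_replace C β (X k))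
      (normalCut (hC.replace_right hC₂' (isReplace_replace C β (X k))) f g)
  -- Both premises act on the cut channel. Typing of the cut identifies the two formulas, and with
  -- them the index sets.
  | .output none s n X k hα C₁' hC₁' f, .input none s' m Y hβ C₂' hC₂' g =>
    normalCut (hC.replace_none hC₁' (by
      have := (Formula.big_inj ((hC.right_none hβ).2.symm.trans (hC.left_none hα).2)).choose_spec k
      exact this ▸ hC₂' (Fin.cast _ k))) f
      (g (Fin.cast (Formula.big_inj ((hC.right_none hβ).2.symm.trans (hC.left_none hα).2)).choose k))
  | .input none s n X hα C₁' hC₁' f, .output none s' m Y k hβ C₂' hC₂' g =>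
    normalCut (hC.replace_none (by
      have := (Formula.big_inj ((hC.left_none hα).2.symm.trans (hC.right_none hβ).2)).choose_spec k
      exact this ▸ hC₁' (Fin.cast _ k)) hC₂')
      (f (Fin.cast (Formula.big_inj ((hC.left_none hα).2.symm.trans (hC.right_none hβ).2)).choose k)) g
  -- For normal premises only trees of polymaps get here. For other premises this is a default
  -- value.
  | f, g => leafCut hC f g
  termination_by f.height + g.height
  decreasing_by
    · have := height_lt_input f i; simp only [height]; omega
    · simp only [height]; omega
    · have := height_lt_input g i; simp only [height]; omega
    · simp only [height]; omega
    · have := height_lt_input g (Fin.cast (Formula.big_inj ((hC.right_none hβ).2.symm.trans (hC.left_none hα).2)).choose k)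
      simp only [height]; omega
    · have := height_lt_input f (Fin.cast (Formula.big_inj ((hC.left_none hα).2.symm.trans (hC.right_none hβ).2)).choose k)
      simp only [height]; omega

section

variable {V : Type} {C : Sequent P.Obj V} {S : Set V} {Z : Formula P.Obj}
  {C₁ : Sequent P.Obj (Option S)} {C₂ : Sequent P.Obj (Option ↥Sᶜ)} (hC : IsCut C S Z C₁ C₂)

theorem normalCut_input_left {α : S} {s n X hα C₁' hC₁'} {f : ∀ i, Term P (C₁' i)} {g : Term P C₂}
    {D : Fin n → Sequent P.Obj V} (hα') (hD : ∀ i, IsReplace C α.1 (X i) (D i))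
    (hC' : ∀ i, IsCut (D i) S Z (C₁' i) C₂) :
    normalCut hC (.input (some α) s n X hα C₁' hC₁' f) g =
      .input α.1 s n X hα' D hD (fun i => normalCut (hC' i) (f i) g) := by
  obtain rfl : D = fun i => replace C α (X i) :=
    funext fun i => (hD i).unique (isReplace_replace C α (X i))
  rw [normalCut]

theorem normalCut_output_left {α : S} {s n X k hα C₁' hC₁'} {f : Term P C₁'} {g : Term P C₂}
    {D : Sequent P.Obj V} (hα') (hD : IsReplace C α.1 (X k) D) (hC' : IsCut D S Z C₁' C₂) :
    normalCut hC (.output (some α) s n X k hα C₁' hC₁' f) g =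
      .output α.1 s n X k hα' D hD (normalCut hC' f g) := by
  obtain rfl : D = replace C α (X k) := hD.unique (isReplace_replace C α (X k))
  rw [normalCut]

theorem normalCut_injection_cotuple {n X k hα C₁' hC₁' hβ C₂' hC₂'} {f : Term P C₁'}
    {g : ∀ i, Term P (C₂' i)} (hC' : IsCut C S (X k) C₁' (C₂' k)) :
    normalCut hC (.output none .cod n X k hα C₁' hC₁' f) (.input none .dom n X hβ C₂' hC₂' g) =
      normalCut hC' f (g k) := by
  rw [normalCut]
  -- Both formulas are literally equal here, so the cast of `k` computes to `k`.
  rfl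

theorem normalCut_tuple_projection {n X k hα C₁' hC₁' hβ C₂' hC₂'} {f : ∀ i, Term P (C₁' i)}
    {g : Term P C₂'} (hC' : IsCut C S (X k) (C₁' k) C₂') :
    normalCut hC (.input none .cod n X hα C₁' hC₁' f) (.output none .dom n X k hβ C₂' hC₂' g) =
      normalCut hC' (f k) g := by
  rw [normalCut]
  rfl

/-- The term does not start with an operation on a channel other than the cut channel. -/
def NoneHeaded {W : Type} {D : Sequent P.Obj (Option W)} : Term P D → Prop
  | .input (some _) _ _ _ _ _ _ _ => False
  | .output (some _) _ _ _ _ _ _ _ _ => False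
  | _ => True

/-- If the left premise has no free operation at its head, the prioritised branches are skipped and
the commutation is an equality. In general it holds only up to conversions. -/
theorem normalCut_input_right' {β : ↥Sᶜ} {s n X hβ C₂' hC₂'} {f : Term P C₁} (hf : f.NoneHeaded)
    {g : ∀ i, Term P (C₂' i)} {D : Fin n → Sequent P.Obj V} (hβ')
    (hD : ∀ i, IsReplace C β.1 (X i) (D i)) (hC' : ∀ i, IsCut (D i) S Z C₁ (C₂' i)) :
    normalCut hC f (.input (some β) s n X hβ C₂' hC₂' g) =
      .input β.1 s n X hβ' D hD (fun i => normalCut (hC' i) f (g i)) := by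
  obtain rfl : D = fun i => replace C β (X i) :=
    funext fun i => (hD i).unique (isReplace_replace C β (X i))
  rw [normalCut]
  · rintro α s n X hα C' hC' f rfl
    exact hf
  · rintro α s n X k hα C' hC' f rfl
    exact hf

theorem normalCut_output_right' {β : ↥Sᶜ} {s n X k hβ C₂' hC₂'} {f : Term P C₁}
    (hf : f.NoneHeaded) {g : Term P C₂'} {D : Sequent P.Obj V} (hβ')
    (hD : IsReplace C β.1 (X k) D) (hC' : IsCut D S Z C₁ C₂') :
    normalCut hC f (.output (some β) s n X k hβ C₂' hC₂' g) =
      .output β.1 s n X k hβ' D hD (normalCut hC' f g) := by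
  obtain rfl : D = replace C β (X k) := hD.unique (isReplace_replace C β (X k))
  rw [normalCut]
  · rintro α s n X hα C' hC' f rfl
    exact hf
  · rintro α s n X k hα C' hC' f rfl
    exact hf

end

/-! ### Congruences -/

/-- A single step acts in one branch of a tuple only, so a family of steps is performed one index at
a time. -/
theorem rel_pi_of_update {n : ℕ} {A : Fin n → Type*} {r : ∀ i, A i → A i → Prop}
    {T : (∀ i, A i) → (∀ i, A i) → Prop} (refl : ∀ F, T F F)
    (trans : ∀ {F G H}, T F G → T G H → T F H)
    (h : ∀ F i y, r i (F i) y → T F (Function.update F i y)) {F G : ∀ i, A i}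
    (hFG : ∀ i, r i (F i) (G i)) : T F G := by
  have key : ∀ s : Finset (Fin n), T F (fun i => if i ∈ s then G i else F i) := by
    intro s
    induction s using Finset.induction_on with
    | empty => simpa using refl F
    | insert a s ha ih =>
      refine trans ih ?_
      have e : (fun i => if i ∈ insert a s then G i else F i) =
          Function.update (fun i => if i ∈ s then G i else F i) a (G a) := by
        funext i
        by_cases hi : i = a
        · subst hi
          simp
        · simp [hi]
      rw [e]
      exact h _ _ _ (by simpa [ha] using hFG a)
  simpa using key Finset.univ

section

variable {V : Type} {C : Sequent P.Obj V}

/-- Two terms are connected by permuting conversions. -/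
def Equivalent (t t' : Term P C) : Prop := Relation.EqvGen Converts t t'

/-- `t'` arises from `t` by finitely many cut-elimination rewrites. -/
def ReducesTo (t t' : Term P C) : Prop := Relation.ReflTransGen Reduces t t'

theorem Equivalent.refl (t : Term P C) : Equivalent t t := Relation.EqvGen.refl t

theorem Equivalent.of_eq {t t' : Term P C} (h : t = t') : Equivalent t t' := h ▸ .refl t

theorem Equivalent.symm {t t' : Term P C} (h : Equivalent t t') : Equivalent t' t :=
  Relation.EqvGen.symm _ _ h

theorem Equivalent.trans {t t' t'' : Term P C} (h : Equivalent t t') (h' : Equivalent t' t'') :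
    Equivalent t t'' := Relation.EqvGen.trans _ _ _ h h'

theorem Interchange.equivalent {t t' : Term P C} (h : Interchange (fun _ => True) t t') :
    Equivalent t t' := Relation.EqvGen.rel _ _ (.root h)

theorem Equivalent.map {V' : Type} {C' : Sequent P.Obj V'} (F : Term P C → Term P C')
    (hF : ∀ t t', Converts t t' → Converts (F t) (F t')) {t t' : Term P C}
    (h : Equivalent t t') : Equivalent (F t) (F t') := by
  induction h with
  | rel _ _ h => exact .rel _ _ (hF _ _ h)
  | refl => exact .refl _
  | symm _ _ _ ih => exact ih.symm
  | trans _ _ _ _ _ ih ih' => exact ih.trans ih'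

theorem ReducesTo.map {V' : Type} {C' : Sequent P.Obj V'} (F : Term P C → Term P C')
    (hF : ∀ t t', Reduces t t' → Reduces (F t) (F t')) {t t' : Term P C}
    (h : ReducesTo t t') : ReducesTo (F t) (F t') := by
  induction h with
  | refl => exact .refl
  | tail _ h ih => exact ih.tail (hF _ _ h)

theorem Inside.input_update
    {R : ∀ {V : Type} {C : Sequent P.Obj V}, Term P C → Term P C → Prop} {α : V} {s n X hα C' hC'}
    (f : ∀ i, Term P (C' i)) (i : Fin n) {x y : Term P (C' i)} (h : Inside R x y) :
    Inside R (C := C) (.input α s n X hα C' hC' (Function.update f i x))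
      (.input α s n X hα C' hC' (Function.update f i y)) :=
  .input i (by simpa using h) (fun j hj => by simp [hj])

theorem Equivalent.input {α : V} {s n X hα C' hC'} {f f' : ∀ i, Term P (C' i)}
    (h : ∀ i, Equivalent (f i) (f' i)) :
    Equivalent (C := C) (.input α s n X hα C' hC' f) (.input α s n X hα C' hC' f') :=
  rel_pi_of_update (r := fun _ => Equivalent)
    (T := fun F G => Equivalent (.input α s n X hα C' hC' F) (.input α s n X hα C' hC' G))
    (fun _ => .refl _) .trans
    (fun F i y hy => by
      simpa using hy.map (fun x => .input α s n X hα C' hC' (Function.update F i x))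
        (fun _ _ => Inside.input_update F i)) h

theorem Equivalent.output {α : V} {s n X k hα C' hC'} {f f' : Term P C'} (h : Equivalent f f') :
    Equivalent (C := C) (.output α s n X k hα C' hC' f) (.output α s n X k hα C' hC' f') :=
  h.map (fun x => .output α s n X k hα C' hC' x) fun _ _ => .output

theorem ReducesTo.input {α : V} {s n X hα C' hC'} {f f' : ∀ i, Term P (C' i)}
    (h : ∀ i, ReducesTo (f i) (f' i)) :
    ReducesTo (C := C) (.input α s n X hα C' hC' f) (.input α s n X hα C' hC' f') :=
  rel_pi_of_update (r := fun _ => ReducesTo)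
    (T := fun F G => ReducesTo (.input α s n X hα C' hC' F) (.input α s n X hα C' hC' G))
    (fun _ => .refl) .trans
    (fun F i y hy => by
      simpa using hy.map (fun x => .input α s n X hα C' hC' (Function.update F i x))
        (fun _ _ => Inside.input_update F i)) h

theorem ReducesTo.output {α : V} {s n X k hα C' hC'} {f f' : Term P C'} (h : ReducesTo f f') :
    ReducesTo (C := C) (.output α s n X k hα C' hC' f) (.output α s n X k hα C' hC' f') :=
  h.map (fun x => .output α s n X k hα C' hC' x) fun _ _ => .output

theorem ReducesTo.cut {S Z C₁ C₂} {hC : IsCut C S Z C₁ C₂} {f f' : Term P C₁} {g g' : Term P C₂}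
    (hf : ReducesTo f f') (hg : ReducesTo g g') :
    ReducesTo (.cut S Z C₁ C₂ hC f g) (.cut S Z C₁ C₂ hC f' g') :=
  Relation.ReflTransGen.trans (hf.map (fun x => .cut S Z C₁ C₂ hC x g) fun _ _ => .cut_left)
    (hg.map (fun x => .cut S Z C₁ C₂ hC f' x) fun _ _ => .cut_right)

end

/-! ### Normal terms -/

/-- A term that is built from polymaps by cuts. -/
def AtomTree : {V : Type} → {C : Sequent P.Obj V} → Term P C → Prop
  | _, _, @Term.atom _ _ _ _ _ _ _ => True
  | _, _, .cut _ _ _ _ _ f g => AtomTree f ∧ AtomTree g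
  | _, _, .input _ _ _ _ _ _ _ _ => False
  | _, _, .output _ _ _ _ _ _ _ _ _ => False

/-- A term that is built by inputs and outputs from cuts of polymaps. -/
def Normal : {V : Type} → {C : Sequent P.Obj V} → Term P C → Prop
  | _, _, @Term.atom _ _ _ _ _ _ _ => True
  | _, _, .cut _ _ _ _ _ f g => AtomTree f ∧ AtomTree g
  | _, _, .input _ _ _ _ _ _ _ f => ∀ i, Normal (f i)
  | _, _, .output _ _ _ _ _ _ _ _ f => Normal f

/-- Every free channel can be traced through the cuts to a polymap. Hence a tree of polymaps can
never face an operation on the cut channel. -/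
theorem AtomTree.exists_atom {V : Type} {C : Sequent P.Obj V} {t : Term P C} (h : t.AtomTree)
    (α : V) : ∃ a, (C α).2 = .atom a := by
  induction t with
  | atom A m hC => exact ⟨_, by rw [hC]⟩
  | input => exact h.elim
  | output => exact h.elim
  | cut S Z C₁ C₂ hC f g ihf ihg =>
    by_cases hα : α ∈ S
    · rw [← hC.2.1 ⟨α, hα⟩]
      exact ihf h.1 _
    · rw [← hC.2.2.2 ⟨α, hα⟩]
      exact ihg h.2 _

theorem AtomTree.not_inside {ok : ℕ → Prop} {V : Type} {C : Sequent P.Obj V} {t t' : Term P C}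
    (h : Inside (Interchange ok) t t') : ¬ t.AtomTree ∧ ¬ t'.AtomTree := by
  induction h with
  | root h => cases h <;> simp [AtomTree]
  | input => simp [AtomTree]
  | output => simp [AtomTree]
  | cut_left _ ih => simp [AtomTree, ih]
  | cut_right _ ih => simp [AtomTree, ih]

/-- Conversions rearrange inputs and outputs, none of which occur in a tree of polymaps. -/
theorem normal_iff_of_inside {ok : ℕ → Prop} {V : Type} {C : Sequent P.Obj V} {t t' : Term P C}
    (h : Inside (Interchange ok) t t') : t.Normal ↔ t'.Normal := by
  induction h with
  | root h =>
    cases h with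
    | input_input => simp only [Normal]; exact forall_comm
    | input_output => simp only [Normal]
    | output_output => simp only [Normal]
  | @input _ _ _ _ _ _ _ _ _ f f' i hi hne ih =>
    have : ∀ j, (f j).Normal ↔ (f' j).Normal := by
      intro j
      by_cases hj : j = i
      · exact hj ▸ ih
      · rw [hne j hj]
    simp only [Normal, this]
  | output _ ih => simpa only [Normal] using ih
  | cut_left h => simp [Normal, AtomTree.not_inside h]
  | cut_right h => simp [Normal, AtomTree.not_inside h]

theorem AtomTree.normal {V : Type} {C : Sequent P.Obj V} {t : Term P C} (h : t.AtomTree) :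
    t.Normal := by
  cases t with
  | atom => trivial
  | cut => exact h
  | input => exact h.elim
  | output => exact h.elim

section

variable {V : Type} {C : Sequent P.Obj V} {S : Set V} {Z : Formula P.Obj}
  {C₁ : Sequent P.Obj (Option S)} {C₂ : Sequent P.Obj (Option ↥Sᶜ)}

theorem NoneHeaded.atomTree {W : Type} {D : Sequent P.Obj (Option W)} {a : P.Obj} {s : Side}
    (hD : D none = (s, .atom a)) {t : Term P D} (ht : t.NoneHeaded) (hn : t.Normal) :
    t.AtomTree := by
  match t, ht, hn with
  | @Term.atom _ _ _ _ _ _ _, _, _ => trivial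
  | .cut _ _ _ _ _ _ _, _, hn => exact hn
  | .input none _ _ _ hα _ _ _, _, _ => rw [hD] at hα; simp at hα
  | .output none _ _ _ _ hα _ _ _, _, _ => rw [hD] at hα; simp at hα
  | .input (some _) _ _ _ _ _ _ _, ht, _ => exact ht.elim
  | .output (some _) _ _ _ _ _ _ _ _, ht, _ => exact ht.elim

/-- A tree of polymaps has atomic channels only, so a compound formula on the cut channel forces the
head operation to act there; the side and connective decide whether it is an input or an output. -/
theorem NoneHeaded.big_cases {W : Type} {D : Sequent P.Obj (Option W)} {s : Side} {c : Connective}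
    {n : ℕ} {X : Fin n → Formula P.Obj} (hD : D none = (s, .big c n X)) {t : Term P D}
    (ht : t.NoneHeaded) (hn : t.Normal) :
    (c = s.input ∧ ∃ hα D' hD', ∃ t' : ∀ i, Term P (D' i), (∀ i, (t' i).Normal) ∧
      t = .input none s n X hα D' hD' t') ∨
    (c = s.output ∧ ∃ k hα D' hD', ∃ t' : Term P D', t'.Normal ∧
      t = .output none s n X k hα D' hD' t') := by
  match t, ht, hn with
  | @Term.atom _ _ _ _ _ _ hC, _, _ => have := hC none; rw [hD] at this; simp at this
  | .cut _ _ _ _ hC f g, _, hn =>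
    obtain ⟨a, ha⟩ := AtomTree.exists_atom (t := .cut _ _ _ _ hC f g) hn none
    rw [hD] at ha
    simp at ha
  | .input none _ _ _ hα _ _ _, _, hn =>
    have := hα.symm.trans hD
    simp only [Prod.mk.injEq, Formula.big.injEq] at this
    obtain ⟨rfl, rfl, rfl, h⟩ := this
    cases h
    exact .inl ⟨rfl, _, _, _, _, hn, rfl⟩
  | .output none _ _ _ k hα D' hD' t', _, hn =>
    have := hα.symm.trans hD
    simp only [Prod.mk.injEq, Formula.big.injEq] at this
    obtain ⟨rfl, rfl, rfl, h⟩ := this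
    cases h
    exact .inr ⟨rfl, k, hα, D', hD', t', hn, rfl⟩
  | .input (some _) _ _ _ _ _ _ _, ht, _ => exact ht.elim
  | .output (some _) _ _ _ _ _ _ _ _, ht, _ => exact ht.elim

variable (hC : IsCut C S Z C₁ C₂)
include hC

/-- Inputs and outputs are dual: an input on the cut channel of the left premise makes the cut
formula a product, and on a product in the domain only an output is possible. -/
theorem NoneHeaded.right_of_input {s n X} (h : C₁ none = (s, .big s.input n X)) {g : Term P C₂}
    (hg : g.NoneHeaded) (hn : g.Normal) :
    s = .cod ∧ ∃ k hβ C₂' hC₂', ∃ g' : Term P C₂', g'.Normal ∧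
      g = .output none .dom n X k hβ C₂' hC₂' g' := by
  obtain ⟨rfl, rfl⟩ := hC.left_none h
  rcases hg.big_cases hC.2.2.1 hn with ⟨e, -⟩ | ⟨-, h⟩
  · cases e
  · exact ⟨rfl, h⟩

theorem NoneHeaded.right_of_output {s n X} (h : C₁ none = (s, .big s.output n X)) {g : Term P C₂}
    (hg : g.NoneHeaded) (hn : g.Normal) :
    s = .cod ∧ ∃ hβ C₂' hC₂', ∃ g' : ∀ i, Term P (C₂' i), (∀ i, (g' i).Normal) ∧
      g = .input none .dom n X hβ C₂' hC₂' g' := by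
  obtain ⟨rfl, rfl⟩ := hC.left_none h
  rcases hg.big_cases hC.2.2.1 hn with ⟨-, h⟩ | ⟨e, -⟩
  · exact ⟨rfl, h⟩
  · cases e

theorem NoneHeaded.left_of_input {s n X} (h : C₂ none = (s, .big s.input n X)) {f : Term P C₁}
    (hf : f.NoneHeaded) (hn : f.Normal) :
    s = .dom ∧ ∃ k hβ C₁' hC₁', ∃ f' : Term P C₁', f'.Normal ∧
      f = .output none .cod n X k hβ C₁' hC₁' f' := by
  obtain ⟨rfl, rfl⟩ := hC.right_none h
  rcases hf.big_cases hC.1 hn with ⟨e, -⟩ | ⟨-, h⟩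
  · cases e
  · exact ⟨rfl, h⟩

theorem NoneHeaded.left_of_output {s n X} (h : C₂ none = (s, .big s.output n X)) {f : Term P C₁}
    (hf : f.NoneHeaded) (hn : f.Normal) :
    s = .dom ∧ ∃ hβ C₁' hC₁', ∃ f' : ∀ i, Term P (C₁' i), (∀ i, (f' i).Normal) ∧
      f = .input none .cod n X hβ C₁' hC₁' f' := by
  obtain ⟨rfl, rfl⟩ := hC.right_none h
  rcases hf.big_cases hC.1 hn with ⟨-, h⟩ | ⟨e, -⟩
  · exact ⟨rfl, h⟩
  · cases e

end

/-! ### Cut elimination modulo the permuting conversions -/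

section

variable {V : Type} {C : Sequent P.Obj V} {S : Set V} {Z : Formula P.Obj}
  {C₁ : Sequent P.Obj (Option S)} {C₂ : Sequent P.Obj (Option ↥Sᶜ)}

theorem noneHeaded_or {W : Type} {D : Sequent P.Obj (Option W)} (t : Term P D) :
    t.NoneHeaded ∨
    (∃ α s n X hα D' hD', ∃ t' : ∀ i, Term P (D' i), t = .input (some α) s n X hα D' hD' t') ∨
    (∃ α s n X k hα D' hD', ∃ t' : Term P D', t = .output (some α) s n X k hα D' hD' t') := by
  match t with
  | @Term.atom _ _ _ _ _ _ _ => exact .inl trivial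
  | .cut _ _ _ _ _ _ _ => exact .inl trivial
  | .input none _ _ _ _ _ _ _ => exact .inl trivial
  | .output none _ _ _ _ _ _ _ _ => exact .inl trivial
  | .input (some α) s n X hα D' hD' t' => exact .inr (.inl ⟨α, s, n, X, hα, D', hD', t', rfl⟩)
  | .output (some α) s n X k hα D' hD' t' =>
    exact .inr (.inr ⟨α, s, n, X, k, hα, D', hD', t', rfl⟩)

theorem ne_of_mem_of_mem_compl {V : Type} {S : Set V} (α : S) (β : ↥Sᶜ) : α.1 ≠ β.1 :=
  fun e => β.2 ((congrArg (· ∈ S) e).mp α.2)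

/-- Induction on the height of the left premise. A free operation on `α` at its head is extracted
first by the strategy, the induction hypothesis extracts `β` beneath it, and one conversion
exchanges the two; `α ≠ β` because they come from different premises. Since `α` may carry a nullary
input, nullary conversions are indispensable here. -/
theorem normalCut_input_right_aux (N : ℕ) : ∀ {V : Type} {C : Sequent P.Obj V} {S : Set V}
    {Z : Formula P.Obj} {C₁ : Sequent P.Obj (Option S)} {C₂ : Sequent P.Obj (Option ↥Sᶜ)}
    (hC : IsCut C S Z C₁ C₂) {f : Term P C₁} {β : ↥Sᶜ} {s n X hβ C₂' hC₂'}
    {g : ∀ i, Term P (C₂' i)} {D : Fin n → Sequent P.Obj V} (hβ')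
    (hD : ∀ i, IsReplace C β.1 (X i) (D i)) (hC' : ∀ i, IsCut (D i) S Z C₁ (C₂' i)),
    f.height < N →
    Equivalent (normalCut hC f (.input (some β) s n X hβ C₂' hC₂' g))
      (.input β.1 s n X hβ' D hD (fun i => normalCut (hC' i) f (g i))) := by
  induction N with
  | zero => intros; omega
  | succ N ih =>
    intro V C S Z C₁ C₂ hC f β s n X hβ C₂' hC₂' g D hβ' hD hC' hN
    rcases noneHeaded_or f with hf | ⟨α, s', m, Y, hα, C₁', hC₁', f, rfl⟩ |
      ⟨α, s', m, Y, k, hα, C₁', hC₁', f, rfl⟩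
    · exact .of_eq (normalCut_input_right' hC hf hβ' hD hC')
    · have hne := ne_of_mem_of_mem_compl α β
      have hA := fun i => isReplace_replace C α.1 (Y i)
      have hB := fun i j => isReplace_replace (replace C α.1 (Y i)) β.1 (X j)
      have hAC := fun i => hC.replace_left (hC₁' i) (hA i)
      have hBC := fun i j => (hAC i).replace_right (hC₂' j) (hB i j)
      have hβA := fun i => ((hA i).2 _ hne.symm).trans hβ'
      have hαC := (hC.2.1 α).symm.trans hα
      rw [normalCut_input_left hC hαC hA hAC]
      refine (Equivalent.input fun i => ih (hAC i) (hβA i) (hB i) (hBC i) ?_).trans ?_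
      · have := height_lt_input f i
        simp only [height] at hN
        omega
      · refine (Interchange.input_input hne trivial trivial
          (hβ' := hβ') (hD := hD)
          (hα' := fun j => ((hD j).2 _ hne).trans hαC)
          (hD' := fun j i => (hA i).swap hne (hB i j) (hD j))).equivalent.trans ?_
        refine Equivalent.input fun j => .of_eq ?_
        exact (normalCut_input_left _ _ _ _).symm
    · have hne := ne_of_mem_of_mem_compl α β
      have hA := isReplace_replace C α.1 (Y k)
      have hB := fun j => isReplace_replace (replace C α.1 (Y k)) β.1 (X j)
      have hAC := hC.replace_left hC₁' hA
      have hBC := fun j => hAC.replace_right (hC₂' j) (hB j)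
      have hβA := (hA.2 _ hne.symm).trans hβ'
      have hαC := (hC.2.1 α).symm.trans hα
      rw [normalCut_output_left hC hαC hA hAC]
      refine (Equivalent.output (ih hAC hβA hB hBC ?_)).trans ?_
      · simp only [height] at hN
        omega
      -- The rule has the input outermost on its left side, so it is applied backwards, with `β` as
      -- the inputting channel.
      · refine (Interchange.input_output hne.symm trivial (hα := hβ') (hC' := hD)
          (hβ := fun j => ((hD j).2 _ hne).trans hαC)
          (hC'' := fun j => hA.swap hne (hB j) (hD j))).equivalent.symm.trans ?_
        refine Equivalent.input fun j => .of_eq ?_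
        exact (normalCut_output_left _ _ _ _).symm

theorem normalCut_output_right_aux (N : ℕ) : ∀ {V : Type} {C : Sequent P.Obj V} {S : Set V}
    {Z : Formula P.Obj} {C₁ : Sequent P.Obj (Option S)} {C₂ : Sequent P.Obj (Option ↥Sᶜ)}
    (hC : IsCut C S Z C₁ C₂) {f : Term P C₁} {β : ↥Sᶜ} {s n X l hβ C₂' hC₂'}
    {g : Term P C₂'} {D : Sequent P.Obj V} (hβ')
    (hD : IsReplace C β.1 (X l) D) (hC' : IsCut D S Z C₁ C₂'),
    f.height < N →
    Equivalent (normalCut hC f (.output (some β) s n X l hβ C₂' hC₂' g))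
      (.output β.1 s n X l hβ' D hD (normalCut hC' f g)) := by
  induction N with
  | zero => intros; omega
  | succ N ih =>
    intro V C S Z C₁ C₂ hC f β s n X l hβ C₂' hC₂' g D hβ' hD hC' hN
    rcases noneHeaded_or f with hf | ⟨α, s', m, Y, hα, C₁', hC₁', f, rfl⟩ |
      ⟨α, s', m, Y, k, hα, C₁', hC₁', f, rfl⟩
    · exact .of_eq (normalCut_output_right' hC hf hβ' hD hC')
    · have hne := ne_of_mem_of_mem_compl α β
      have hA := fun i => isReplace_replace C α.1 (Y i)
      have hB := fun i => isReplace_replace (replace C α.1 (Y i)) β.1 (X l)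
      have hAC := fun i => hC.replace_left (hC₁' i) (hA i)
      have hBC := fun i => (hAC i).replace_right hC₂' (hB i)
      have hβA := fun i => ((hA i).2 _ hne.symm).trans hβ'
      have hαC := (hC.2.1 α).symm.trans hα
      rw [normalCut_input_left hC hαC hA hAC]
      refine (Equivalent.input fun i => ih (hAC i) (hβA i) (hB i) (hBC i) ?_).trans ?_
      · have := height_lt_input f i
        simp only [height] at hN
        omega
      · refine (Interchange.input_output hne trivial
          (hβ' := hβ') (hD := hD)
          (hα' := (hD.2 _ hne).trans hαC)
          (hD' := fun i => (hA i).swap hne (hB i) hD)).equivalent.trans ?_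
        exact Equivalent.output (.of_eq (normalCut_input_left _ _ _ _).symm)
    · have hne := ne_of_mem_of_mem_compl α β
      have hA := isReplace_replace C α.1 (Y k)
      have hB := isReplace_replace (replace C α.1 (Y k)) β.1 (X l)
      have hAC := hC.replace_left hC₁' hA
      have hBC := hAC.replace_right hC₂' hB
      have hβA := (hA.2 _ hne.symm).trans hβ'
      have hαC := (hC.2.1 α).symm.trans hα
      rw [normalCut_output_left hC hαC hA hAC]
      refine (Equivalent.output (ih hAC hβA hB hBC ?_)).trans ?_
      · simp only [height] at hN
        omega
      · refine (Interchange.output_output hne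
          (hβ' := hβ') (hD := hD)
          (hα' := (hD.2 _ hne).trans hαC)
          (hD' := hA.swap hne hB hD)).equivalent.trans ?_
        exact Equivalent.output (.of_eq (normalCut_output_left _ _ _ _).symm)

variable (hC : IsCut C S Z C₁ C₂)

theorem normalCut_input_right {f : Term P C₁} {β : ↥Sᶜ} {s n X hβ C₂' hC₂'}
    {g : ∀ i, Term P (C₂' i)} {D : Fin n → Sequent P.Obj V} (hβ')
    (hD : ∀ i, IsReplace C β.1 (X i) (D i)) (hC' : ∀ i, IsCut (D i) S Z C₁ (C₂' i)) :
    Equivalent (normalCut hC f (.input (some β) s n X hβ C₂' hC₂' g))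
      (.input β.1 s n X hβ' D hD (fun i => normalCut (hC' i) f (g i))) :=
  normalCut_input_right_aux _ hC hβ' hD hC' (Nat.lt_succ_self _)

theorem normalCut_output_right {f : Term P C₁} {β : ↥Sᶜ} {s n X l hβ C₂' hC₂'}
    {g : Term P C₂'} {D : Sequent P.Obj V} (hβ')
    (hD : IsReplace C β.1 (X l) D) (hC' : IsCut D S Z C₁ C₂') :
    Equivalent (normalCut hC f (.output (some β) s n X l hβ C₂' hC₂' g))
      (.output β.1 s n X l hβ' D hD (normalCut hC' f g)) :=
  normalCut_output_right_aux _ hC hβ' hD hC' (Nat.lt_succ_self _)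

end

/-! ### Invariance of `normalCut` under conversions in a premise -/

section

variable {V : Type} {C : Sequent P.Obj V} {S : Set V} {Z : Formula P.Obj}
  {C₁ : Sequent P.Obj (Option S)} {C₂ : Sequent P.Obj (Option ↥Sᶜ)} (hC : IsCut C S Z C₁ C₂)

/-- The right premise must be a projection, which selects branch `k` of the tuple. Selecting before
or after extracting the input on `b` gives the same term, so the conversion disappears. -/
theorem normalCut_left_input_input_none {w : Term P C₂} (hw : w.NoneHeaded) (hn : w.Normal)
    {b : S} {s n X s' m Y} {hα : C₁ none = (s, .big s.input n X)}
    {C' hC'} {hβ : ∀ i, C' i (some b) = (s', .big s'.input m Y)}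
    {C'' : Fin n → Fin m → Sequent P.Obj _} {hC'' : ∀ i j, IsReplace (C' i) (some b) (Y j) (C'' i j)}
    {hβ' D hD} {hα' : ∀ j, D j none = (s, .big s.input n X)}
    {hD' : ∀ j i, IsReplace (D j) none (X i) (C'' i j)} {t : ∀ i j, Term P (C'' i j)} :
    Equivalent
      (normalCut hC (.input none s n X hα C' hC' fun i =>
        .input (some b) s' m Y (hβ i) (C'' i) (hC'' i) fun j => t i j) w)
      (normalCut hC (.input (some b) s' m Y hβ' D hD fun j =>
        .input none s n X (hα' j) (fun i => C'' i j) (hD' j) fun i => t i j) w) := by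
  obtain ⟨rfl, k, hγ, E, hE, u, hu, rfl⟩ := NoneHeaded.right_of_input hC hα hw hn
  have hb := (hC.2.1 b).symm.trans hβ'
  have hK := hC.replace_none (hC' k) hE
  have hA := fun j => isReplace_replace C b (Y j)
  have hKA := fun j => hK.replace_left (hC'' k j) (hA j)
  have hCA := fun j => hC.replace_left (hD j) (hA j)
  refine (Equivalent.of_eq (normalCut_tuple_projection hC hK)).trans ?_
  refine (Equivalent.of_eq (normalCut_input_left hK hb hA hKA)).trans (.trans (.symm ?_) (Equivalent.of_eq (normalCut_input_left hC hb hA hCA)).symm)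
  exact .input fun j => .of_eq (normalCut_tuple_projection (hCA j) (hKA j))

theorem normalCut_left_output_output_none {w : Term P C₂} (hw : w.NoneHeaded) (hn : w.Normal)
    {b : S} {s n X k s' m Y l} {hα : C₁ none = (s, .big s.output n X)}
    {C' hC' hβ C'' hC'' hβ' D hD hα' hD'} {t : Term P C''} :
    Equivalent
      (normalCut hC (.output none s n X k hα C' hC' (.output (some b) s' m Y l hβ C'' hC'' t)) w)
      (normalCut hC (.output (some b) s' m Y l hβ' D hD (.output none s n X k hα' C'' hD' t)) w) := by
  obtain ⟨rfl, hγ, E, hE, u, hu, rfl⟩ := NoneHeaded.right_of_output hC hα hw hn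
  have hb := (hC.2.1 b).symm.trans hβ'
  have hK := hC.replace_none hC' (hE k)
  have hA := isReplace_replace C b (Y l)
  have hKA := hK.replace_left hC'' hA
  have hCA := hC.replace_left hD hA
  refine (Equivalent.of_eq (normalCut_injection_cotuple hC hK)).trans ?_
  refine (Equivalent.of_eq (normalCut_output_left hK hb hA hKA)).trans (.trans (.symm ?_) (Equivalent.of_eq (normalCut_output_left hC hb hA hCA)).symm)
  exact .output (.of_eq (normalCut_injection_cotuple hCA hKA))

/-- If both channels are free, the same conversion reappears outside the cut. If one is the cut
channel, its operation cancels against the dual operation that `w` is forced to have. -/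
theorem normalCut_interchange_left {w : Term P C₂} (hw : w.NoneHeaded) (hn : w.Normal)
    {t t' : Term P C₁} (h : Interchange (fun _ => True) t t') :
    Equivalent (normalCut hC t w) (normalCut hC t' w) := by
  cases h with
  | @input_input α β hne s n X s' m Y _ _ hα C' hC' hβ C'' hC'' hβ' D hD hα' hD' t =>
    match α, β with
    | none, none => exact absurd rfl hne
    | none, some b => exact normalCut_left_input_input_none hC hw hn
    | some a, none =>
      exact (normalCut_left_input_input_none hC hw hn (hα := hβ') (hC' := hD) (hβ := hα')
        (hC'' := hD') (hβ' := hα) (hD := hC') (hα' := hβ) (hD' := hC'')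
        (t := fun j i => t i j)).symm
    | some a, some b =>
      have hne' : a.1 ≠ b.1 := fun e => hne (congrArg some (Subtype.ext e))
      have ha := (hC.2.1 a).symm.trans hα
      have hb := (hC.2.1 b).symm.trans hβ'
      have hA := fun i => isReplace_replace C a (X i)
      have hB := fun j => isReplace_replace C b (Y j)
      have hAB := fun i j => isReplace_replace (replace C a (X i)) b (Y j)
      have hBA := fun j i => (hA i).swap hne' (hAB i j) (hB j)
      have hCA := fun i => hC.replace_left (hC' i) (hA i)
      have hCB := fun j => hC.replace_left (hD j) (hB j)
      have hCAB := fun i j => (hCA i).replace_left (hC'' i j) (hAB i j)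
      have hb' := fun i => ((hCA i).2.1 b).symm.trans (hβ i)
      have ha' := fun j => ((hCB j).2.1 a).symm.trans (hα' j)
      refine (Equivalent.of_eq (normalCut_input_left hC ha hA hCA)).trans ?_
      refine (Equivalent.input fun i => Equivalent.of_eq (normalCut_input_left (hCA i) (hb' i) (hAB i) (hCAB i))).trans ?_
      refine (Interchange.input_input hne' trivial trivial (hβ' := hb) (hD := hB) (hα' := ha')
        (hD' := hBA)).equivalent.trans ?_
      refine .trans (.symm ?_) (Equivalent.of_eq (normalCut_input_left hC hb hB hCB)).symm
      exact .input fun j => Equivalent.of_eq (normalCut_input_left (hCB j) (ha' j) (hBA j) (fun i => hCAB i j))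
  | @input_output α β hne s n X s' m Y k _ hα C' hC' hβ C'' hC'' hβ' D hD hα' hD' t =>
    match α, β with
    | none, none => exact absurd rfl hne
    | none, some b =>
      obtain ⟨rfl, l, hγ, E, hE, u, hu, rfl⟩ := NoneHeaded.right_of_input hC hα hw hn
      have hb := (hC.2.1 b).symm.trans hβ'
      have hK := hC.replace_none (hC' l) hE
      have hA := isReplace_replace C b (Y k)
      have hKA := hK.replace_left (hC'' l) hA
      have hCA := hC.replace_left hD hA
      refine (Equivalent.of_eq (normalCut_tuple_projection hC hK)).trans ?_
      refine (Equivalent.of_eq (normalCut_output_left hK hb hA hKA)).trans (.trans (.symm ?_) (Equivalent.of_eq (normalCut_output_left hC hb hA hCA)).symm)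
      exact .output (.of_eq (normalCut_tuple_projection hCA hKA))
    | some a, none =>
      obtain ⟨rfl, hγ, E, hE, u, hu, rfl⟩ := NoneHeaded.right_of_output hC hβ' hw hn
      have ha := (hC.2.1 a).symm.trans hα
      have hK := hC.replace_none hD (hE k)
      have hA := fun i => isReplace_replace C a (X i)
      have hKA := fun i => hK.replace_left (hD' i) (hA i)
      have hCA := fun i => hC.replace_left (hC' i) (hA i)
      refine .trans ?_ (Equivalent.of_eq (normalCut_injection_cotuple hC hK)).symm
      refine (Equivalent.of_eq (normalCut_input_left hC ha hA hCA)).trans (.trans ?_ (Equivalent.of_eq (normalCut_input_left hK ha hA hKA)).symm)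
      exact .input fun i => .of_eq (normalCut_injection_cotuple (hCA i) (hKA i))
    | some a, some b =>
      have hne' : a.1 ≠ b.1 := fun e => hne (congrArg some (Subtype.ext e))
      have ha := (hC.2.1 a).symm.trans hα
      have hb := (hC.2.1 b).symm.trans hβ'
      have hA := fun i => isReplace_replace C a (X i)
      have hB := isReplace_replace C b (Y k)
      have hAB := fun i => isReplace_replace (replace C a (X i)) b (Y k)
      have hBA := fun i => (hA i).swap hne' (hAB i) hB
      have hCA := fun i => hC.replace_left (hC' i) (hA i)
      have hCB := hC.replace_left hD hB
      have hCAB := fun i => (hCA i).replace_left (hC'' i) (hAB i)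
      have hb' := fun i => ((hCA i).2.1 b).symm.trans (hβ i)
      have ha' := (hCB.2.1 a).symm.trans hα'
      refine (Equivalent.of_eq (normalCut_input_left hC ha hA hCA)).trans ?_
      refine (Equivalent.input fun i => Equivalent.of_eq (normalCut_output_left (hCA i) (hb' i) (hAB i) (hCAB i))).trans ?_
      refine (Interchange.input_output hne' trivial (hβ' := hb) (hD := hB) (hα' := ha')
        (hD' := hBA)).equivalent.trans ?_
      refine .trans (.symm ?_) (Equivalent.of_eq (normalCut_output_left hC hb hB hCB)).symm
      exact .output (Equivalent.of_eq (normalCut_input_left hCB ha' hBA hCAB))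
  | @output_output α β hne s n X k s' m Y l hα C' hC' hβ C'' hC'' hβ' D hD hα' hD' t =>
    match α, β with
    | none, none => exact absurd rfl hne
    | none, some b => exact normalCut_left_output_output_none hC hw hn
    | some a, none => exact (normalCut_left_output_output_none hC hw hn).symm
    | some a, some b =>
      have hne' : a.1 ≠ b.1 := fun e => hne (congrArg some (Subtype.ext e))
      have ha := (hC.2.1 a).symm.trans hα
      have hb := (hC.2.1 b).symm.trans hβ'
      have hA := isReplace_replace C a (X k)
      have hB := isReplace_replace C b (Y l)
      have hAB := isReplace_replace (replace C a (X k)) b (Y l)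
      have hBA := hA.swap hne' hAB hB
      have hCA := hC.replace_left hC' hA
      have hCB := hC.replace_left hD hB
      have hCAB := hCA.replace_left hC'' hAB
      have hb' := (hCA.2.1 b).symm.trans hβ
      have ha' := (hCB.2.1 a).symm.trans hα'
      refine (Equivalent.of_eq (normalCut_output_left hC ha hA hCA)).trans ?_
      refine (Equivalent.output (Equivalent.of_eq (normalCut_output_left hCA hb' hAB hCAB))).trans ?_
      refine (Interchange.output_output hne' (hβ' := hb) (hD := hB) (hα' := ha')
        (hD' := hBA)).equivalent.trans ?_
      refine .trans (.symm ?_) (Equivalent.of_eq (normalCut_output_left hC hb hB hCB)).symm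
      exact .output (Equivalent.of_eq (normalCut_output_left hCB ha' hBA hCAB))

/-- Induction on the total height. A free operation at the head of `w` is brought outside on both
sides at once, although the strategy would inspect `t` first; this is what the right commutation
lemmas are for. Otherwise the conversion is at the root of `t`, or it lies below an operation that
comes out or cancels. Only the height of `t` is bounded, since a nullary conversion may alter that
of `t'`. -/
theorem normalCut_converts_left_aux (N : ℕ) : ∀ {V : Type} {C : Sequent P.Obj V} {S : Set V}
    {Z : Formula P.Obj} {C₁ : Sequent P.Obj (Option S)} {C₂ : Sequent P.Obj (Option ↥Sᶜ)}
    (hC : IsCut C S Z C₁ C₂) {w : Term P C₂} {t t' : Term P C₁},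
    w.height + t.height < N → w.Normal → t.Normal → Converts t t' →
    Equivalent (normalCut hC t w) (normalCut hC t' w) := by
  induction N with
  | zero => intros; omega
  | succ N ih =>
    intro V C S Z C₁ C₂ hC w t t' hN hn ht h
    rcases noneHeaded_or w with hw | ⟨α, s, n, X, hα, D, hD, w, rfl⟩ |
      ⟨α, s, n, X, k, hα, D, hD, w, rfl⟩
    · unfold Converts at h
      cases h with
      | root h => exact normalCut_interchange_left hC hw hn h
      | @input _ _ β s n X hβ E hE t t' i hi hij =>
        cases β with
        | none =>
          obtain ⟨rfl, k, hγ, F, hF, u, hu, rfl⟩ := NoneHeaded.right_of_input hC hβ hw hn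
          have hK := hC.replace_none (hE k) hF
          refine .trans (Equivalent.of_eq (normalCut_tuple_projection hC hK))
            (.trans ?_ (Equivalent.of_eq (normalCut_tuple_projection hC hK)).symm)
          -- The projection either selects the converted branch or discards it, in which case both
          -- results are equal.
          by_cases hk : k = i
          · subst hk
            refine ih hK ?_ hu (ht k) hi
            have := height_lt_input t k
            simp only [height] at hN
            omega
          · exact .of_eq (by rw [hij k hk])
        | some b =>
          have hb := (hC.2.1 b).symm.trans hβ
          have hA := fun i => isReplace_replace C b (X i)
          have hCA := fun i => hC.replace_left (hE i) (hA i)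
          refine (Equivalent.of_eq (normalCut_input_left hC hb hA hCA)).trans (.trans ?_ (Equivalent.of_eq (normalCut_input_left hC hb hA hCA)).symm)
          refine .input fun k => ?_
          by_cases hk : k = i
          · subst hk
            refine ih (hCA k) ?_ hn (ht k) hi
            have := height_lt_input t k
            simp only [height] at hN
            omega
          · exact .of_eq (by rw [hij k hk])
      | @output _ _ β s n X k hβ E hE t t' h =>
        cases β with
        | none =>
          obtain ⟨rfl, hγ, F, hF, u, hu, rfl⟩ := NoneHeaded.right_of_output hC hβ hw hn
          have hK := hC.replace_none hE (hF k)
          refine .trans (Equivalent.of_eq (normalCut_injection_cotuple hC hK))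
            (.trans ?_ (Equivalent.of_eq (normalCut_injection_cotuple hC hK)).symm)
          refine ih hK ?_ (hu k) ht h
          have := height_lt_input u k
          simp only [height] at hN
          omega
        | some b =>
          have hb := (hC.2.1 b).symm.trans hβ
          have hA := isReplace_replace C b (X k)
          have hCA := hC.replace_left hE hA
          refine (Equivalent.of_eq (normalCut_output_left hC hb hA hCA)).trans (.trans ?_ (Equivalent.of_eq (normalCut_output_left hC hb hA hCA)).symm)
          refine .output (ih hCA ?_ hn ht h)
          simp only [height] at hN
          omega
      -- Cuts in a normal term contain polymaps and cuts only, so there is nothing to convert.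
      | cut_left h => exact absurd ht.1 (AtomTree.not_inside h).1
      | cut_right h => exact absurd ht.2 (AtomTree.not_inside h).1
    · have hα' := (hC.2.2.2 α).symm.trans hα
      have hA := fun i => isReplace_replace C α (X i)
      have hCA := fun i => hC.replace_right (hD i) (hA i)
      refine (normalCut_input_right hC hα' hA hCA).trans (.trans ?_ (normalCut_input_right hC hα' hA hCA).symm)
      refine .input fun i => ih (hCA i) ?_ (hn i) ht h
      have := height_lt_input w i
      simp only [height] at hN
      omega
    · have hα' := (hC.2.2.2 α).symm.trans hα
      have hA := isReplace_replace C α (X k)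
      have hCA := hC.replace_right hD hA
      refine (normalCut_output_right hC hα' hA hCA).trans (.trans ?_ (normalCut_output_right hC hα' hA hCA).symm)
      refine .output (ih hCA ?_ hn ht h)
      simp only [height] at hN
      omega

theorem normalCut_equivalent_left {w : Term P C₂} (hn : w.Normal) {t t' : Term P C₁}
    (ht : t.Normal) (h : Equivalent t t') : Equivalent (normalCut hC t w) (normalCut hC t' w) := by
  -- Normality is carried along in both directions, because a zigzag passes through intermediate
  -- terms and backward steps.
  have key : (t.Normal ↔ t'.Normal) ∧
      (t.Normal → Equivalent (normalCut hC t w) (normalCut hC t' w)) := by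
    clear ht
    induction h with
    | rel _ _ h =>
      exact ⟨normal_iff_of_inside h,
        fun ht => normalCut_converts_left_aux _ hC (Nat.lt_succ_self _) hn ht h⟩
    | refl => exact ⟨.rfl, fun _ => .refl _⟩
    | symm _ _ _ ih => exact ⟨ih.1.symm, fun ht => (ih.2 (ih.1.2 ht)).symm⟩
    | trans _ _ _ _ _ ih ih' =>
      exact ⟨ih.1.trans ih'.1, fun ht => (ih.2 ht).trans (ih'.2 (ih.1.1 ht))⟩
  exact key.2 ht

theorem normalCut_right_input_input_none {w : Term P C₁} (hw : w.NoneHeaded) (hn : w.Normal)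
    {b : ↥Sᶜ} {s n X s' m Y} {hα : C₂ none = (s, .big s.input n X)}
    {C' hC'} {hβ : ∀ i, C' i (some b) = (s', .big s'.input m Y)}
    {C'' : Fin n → Fin m → Sequent P.Obj _} {hC'' : ∀ i j, IsReplace (C' i) (some b) (Y j) (C'' i j)}
    {hβ' D hD} {hα' : ∀ j, D j none = (s, .big s.input n X)}
    {hD' : ∀ j i, IsReplace (D j) none (X i) (C'' i j)} {t : ∀ i j, Term P (C'' i j)} :
    Equivalent
      (normalCut hC w (.input none s n X hα C' hC' fun i =>
        .input (some b) s' m Y (hβ i) (C'' i) (hC'' i) fun j => t i j))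
      (normalCut hC w (.input (some b) s' m Y hβ' D hD fun j =>
        .input none s n X (hα' j) (fun i => C'' i j) (hD' j) fun i => t i j)) := by
  obtain ⟨rfl, k, hγ, E, hE, u, hu, rfl⟩ := NoneHeaded.left_of_input hC hα hw hn
  have hb := (hC.2.2.2 b).symm.trans hβ'
  have hK := hC.replace_none hE (hC' k)
  have hA := fun j => isReplace_replace C b (Y j)
  have hKA := fun j => hK.replace_right (hC'' k j) (hA j)
  have hCA := fun j => hC.replace_right (hD j) (hA j)
  refine (Equivalent.of_eq (normalCut_injection_cotuple hC hK)).trans ?_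
  refine (normalCut_input_right hK hb hA hKA).trans (.trans (.symm ?_) (normalCut_input_right hC hb hA hCA).symm)
  exact .input fun j => .of_eq (normalCut_injection_cotuple (hCA j) (hKA j))

theorem normalCut_right_output_output_none {w : Term P C₁} (hw : w.NoneHeaded) (hn : w.Normal)
    {b : ↥Sᶜ} {s n X k s' m Y l} {hα : C₂ none = (s, .big s.output n X)}
    {C' hC' hβ C'' hC'' hβ' D hD hα' hD'} {t : Term P C''} :
    Equivalent
      (normalCut hC w (.output none s n X k hα C' hC' (.output (some b) s' m Y l hβ C'' hC'' t)))
      (normalCut hC w (.output (some b) s' m Y l hβ' D hD (.output none s n X k hα' C'' hD' t))) := by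
  obtain ⟨rfl, hγ, E, hE, u, hu, rfl⟩ := NoneHeaded.left_of_output hC hα hw hn
  have hb := (hC.2.2.2 b).symm.trans hβ'
  have hK := hC.replace_none (hE k) hC'
  have hA := isReplace_replace C b (Y l)
  have hKA := hK.replace_right hC'' hA
  have hCA := hC.replace_right hD hA
  refine (Equivalent.of_eq (normalCut_tuple_projection hC hK)).trans ?_
  refine (normalCut_output_right hK hb hA hKA).trans (.trans (.symm ?_) (normalCut_output_right hC hb hA hCA).symm)
  exact .output (.of_eq (normalCut_tuple_projection hCA hKA))

/-- Dual to the left case, except that extraction from the right premise is available only up to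
conversions: once the operation of `w` on the cut channel has been cancelled, the remaining left
premise may start with a free operation. -/
theorem normalCut_interchange_right {w : Term P C₁} (hw : w.NoneHeaded) (hn : w.Normal)
    {t t' : Term P C₂} (h : Interchange (fun _ => True) t t') :
    Equivalent (normalCut hC w t) (normalCut hC w t') := by
  cases h with
  | @input_input α β hne s n X s' m Y _ _ hα C' hC' hβ C'' hC'' hβ' D hD hα' hD' t =>
    match α, β with
    | none, none => exact absurd rfl hne
    | none, some b => exact normalCut_right_input_input_none hC hw hn
    | some a, none =>
      exact (normalCut_right_input_input_none hC hw hn (hα := hβ') (hC' := hD) (hβ := hα')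
        (hC'' := hD') (hβ' := hα) (hD := hC') (hα' := hβ) (hD' := hC'')
        (t := fun j i => t i j)).symm
    | some a, some b =>
      have hne' : a.1 ≠ b.1 := fun e => hne (congrArg some (Subtype.ext e))
      have ha := (hC.2.2.2 a).symm.trans hα
      have hb := (hC.2.2.2 b).symm.trans hβ'
      have hA := fun i => isReplace_replace C a (X i)
      have hB := fun j => isReplace_replace C b (Y j)
      have hAB := fun i j => isReplace_replace (replace C a (X i)) b (Y j)
      have hBA := fun j i => (hA i).swap hne' (hAB i j) (hB j)
      have hCA := fun i => hC.replace_right (hC' i) (hA i)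
      have hCB := fun j => hC.replace_right (hD j) (hB j)
      have hCAB := fun i j => (hCA i).replace_right (hC'' i j) (hAB i j)
      have hb' := fun i => ((hCA i).2.2.2 b).symm.trans (hβ i)
      have ha' := fun j => ((hCB j).2.2.2 a).symm.trans (hα' j)
      refine (normalCut_input_right hC ha hA hCA).trans ?_
      refine (Equivalent.input fun i => normalCut_input_right (hCA i) (hb' i) (hAB i) (hCAB i)).trans ?_
      refine (Interchange.input_input hne' trivial trivial (hβ' := hb) (hD := hB) (hα' := ha')
        (hD' := hBA)).equivalent.trans ?_
      refine .trans (.symm ?_) (normalCut_input_right hC hb hB hCB).symm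
      exact .input fun j => normalCut_input_right (hCB j) (ha' j) (hBA j) (fun i => hCAB i j)
  | @input_output α β hne s n X s' m Y k _ hα C' hC' hβ C'' hC'' hβ' D hD hα' hD' t =>
    match α, β with
    | none, none => exact absurd rfl hne
    | none, some b =>
      obtain ⟨rfl, l, hγ, E, hE, u, hu, rfl⟩ := NoneHeaded.left_of_input hC hα hw hn
      have hb := (hC.2.2.2 b).symm.trans hβ'
      have hK := hC.replace_none hE (hC' l)
      have hA := isReplace_replace C b (Y k)
      have hKA := hK.replace_right (hC'' l) hA
      have hCA := hC.replace_right hD hA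
      refine (Equivalent.of_eq (normalCut_injection_cotuple hC hK)).trans ?_
      refine (normalCut_output_right hK hb hA hKA).trans (.trans (.symm ?_) (normalCut_output_right hC hb hA hCA).symm)
      exact .output (.of_eq (normalCut_injection_cotuple hCA hKA))
    | some a, none =>
      obtain ⟨rfl, hγ, E, hE, u, hu, rfl⟩ := NoneHeaded.left_of_output hC hβ' hw hn
      have ha := (hC.2.2.2 a).symm.trans hα
      have hK := hC.replace_none (hE k) hD
      have hA := fun i => isReplace_replace C a (X i)
      have hKA := fun i => hK.replace_right (hD' i) (hA i)
      have hCA := fun i => hC.replace_right (hC' i) (hA i)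
      refine .trans ?_ (Equivalent.of_eq (normalCut_tuple_projection hC hK)).symm
      refine (normalCut_input_right hC ha hA hCA).trans (.trans ?_ (normalCut_input_right hK ha hA hKA).symm)
      exact .input fun i => .of_eq (normalCut_tuple_projection (hCA i) (hKA i))
    | some a, some b =>
      have hne' : a.1 ≠ b.1 := fun e => hne (congrArg some (Subtype.ext e))
      have ha := (hC.2.2.2 a).symm.trans hα
      have hb := (hC.2.2.2 b).symm.trans hβ'
      have hA := fun i => isReplace_replace C a (X i)
      have hB := isReplace_replace C b (Y k)
      have hAB := fun i => isReplace_replace (replace C a (X i)) b (Y k)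
      have hBA := fun i => (hA i).swap hne' (hAB i) hB
      have hCA := fun i => hC.replace_right (hC' i) (hA i)
      have hCB := hC.replace_right hD hB
      have hCAB := fun i => (hCA i).replace_right (hC'' i) (hAB i)
      have hb' := fun i => ((hCA i).2.2.2 b).symm.trans (hβ i)
      have ha' := (hCB.2.2.2 a).symm.trans hα'
      refine (normalCut_input_right hC ha hA hCA).trans ?_
      refine (Equivalent.input fun i => normalCut_output_right (hCA i) (hb' i) (hAB i) (hCAB i)).trans ?_
      refine (Interchange.input_output hne' trivial (hβ' := hb) (hD := hB) (hα' := ha')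
        (hD' := hBA)).equivalent.trans ?_
      refine .trans (.symm ?_) (normalCut_output_right hC hb hB hCB).symm
      exact .output (normalCut_input_right hCB ha' hBA hCAB)
  | @output_output α β hne s n X k s' m Y l hα C' hC' hβ C'' hC'' hβ' D hD hα' hD' t =>
    match α, β with
    | none, none => exact absurd rfl hne
    | none, some b => exact normalCut_right_output_output_none hC hw hn
    | some a, none => exact (normalCut_right_output_output_none hC hw hn).symm
    | some a, some b =>
      have hne' : a.1 ≠ b.1 := fun e => hne (congrArg some (Subtype.ext e))
      have ha := (hC.2.2.2 a).symm.trans hα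
      have hb := (hC.2.2.2 b).symm.trans hβ'
      have hA := isReplace_replace C a (X k)
      have hB := isReplace_replace C b (Y l)
      have hAB := isReplace_replace (replace C a (X k)) b (Y l)
      have hBA := hA.swap hne' hAB hB
      have hCA := hC.replace_right hC' hA
      have hCB := hC.replace_right hD hB
      have hCAB := hCA.replace_right hC'' hAB
      have hb' := (hCA.2.2.2 b).symm.trans hβ
      have ha' := (hCB.2.2.2 a).symm.trans hα'
      refine (normalCut_output_right hC ha hA hCA).trans ?_
      refine (Equivalent.output (normalCut_output_right hCA hb' hAB hCAB)).trans ?_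
      refine (Interchange.output_output hne' (hβ' := hb) (hD := hB) (hα' := ha')
        (hD' := hBA)).equivalent.trans ?_
      refine .trans (.symm ?_) (normalCut_output_right hC hb hB hCB).symm
      exact .output (normalCut_output_right hCB ha' hBA hCAB)

theorem normalCut_converts_right_aux (N : ℕ) : ∀ {V : Type} {C : Sequent P.Obj V} {S : Set V}
    {Z : Formula P.Obj} {C₁ : Sequent P.Obj (Option S)} {C₂ : Sequent P.Obj (Option ↥Sᶜ)}
    (hC : IsCut C S Z C₁ C₂) {w : Term P C₁} {t t' : Term P C₂},
    w.height + t.height < N → w.Normal → t.Normal → Converts t t' →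
    Equivalent (normalCut hC w t) (normalCut hC w t') := by
  induction N with
  | zero => intros; omega
  | succ N ih =>
    intro V C S Z C₁ C₂ hC w t t' hN hn ht h
    rcases noneHeaded_or w with hw | ⟨α, s, n, X, hα, D, hD, w, rfl⟩ |
      ⟨α, s, n, X, k, hα, D, hD, w, rfl⟩
    · unfold Converts at h
      cases h with
      | root h => exact normalCut_interchange_right hC hw hn h
      | @input _ _ β s n X hβ E hE t t' i hi hij =>
        cases β with
        | none =>
          obtain ⟨rfl, k, hγ, F, hF, u, hu, rfl⟩ := NoneHeaded.left_of_input hC hβ hw hn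
          have hK := hC.replace_none hF (hE k)
          refine .trans (Equivalent.of_eq (normalCut_injection_cotuple hC hK))
            (.trans ?_ (Equivalent.of_eq (normalCut_injection_cotuple hC hK)).symm)
          by_cases hk : k = i
          · subst hk
            refine ih hK ?_ hu (ht k) hi
            have := height_lt_input t k
            simp only [height] at hN
            omega
          · exact .of_eq (by rw [hij k hk])
        | some b =>
          have hb := (hC.2.2.2 b).symm.trans hβ
          have hA := fun i => isReplace_replace C b (X i)
          have hCA := fun i => hC.replace_right (hE i) (hA i)
          refine (normalCut_input_right hC hb hA hCA).trans (.trans ?_ (normalCut_input_right hC hb hA hCA).symm)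
          refine .input fun k => ?_
          by_cases hk : k = i
          · subst hk
            refine ih (hCA k) ?_ hn (ht k) hi
            have := height_lt_input t k
            simp only [height] at hN
            omega
          · exact .of_eq (by rw [hij k hk])
      | @output _ _ β s n X k hβ E hE t t' h =>
        cases β with
        | none =>
          obtain ⟨rfl, hγ, F, hF, u, hu, rfl⟩ := NoneHeaded.left_of_output hC hβ hw hn
          have hK := hC.replace_none (hF k) hE
          refine .trans (Equivalent.of_eq (normalCut_tuple_projection hC hK))
            (.trans ?_ (Equivalent.of_eq (normalCut_tuple_projection hC hK)).symm)
          refine ih hK ?_ (hu k) ht h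
          have := height_lt_input u k
          simp only [height] at hN
          omega
        | some b =>
          have hb := (hC.2.2.2 b).symm.trans hβ
          have hA := isReplace_replace C b (X k)
          have hCA := hC.replace_right hE hA
          refine (normalCut_output_right hC hb hA hCA).trans (.trans ?_ (normalCut_output_right hC hb hA hCA).symm)
          refine .output (ih hCA ?_ hn ht h)
          simp only [height] at hN
          omega
      | cut_left h => exact absurd ht.1 (AtomTree.not_inside h).1
      | cut_right h => exact absurd ht.2 (AtomTree.not_inside h).1
    · have hα' := (hC.2.1 α).symm.trans hα
      have hA := fun i => isReplace_replace C α (X i)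
      have hCA := fun i => hC.replace_left (hD i) (hA i)
      refine (Equivalent.of_eq (normalCut_input_left hC hα' hA hCA)).trans (.trans ?_ (Equivalent.of_eq (normalCut_input_left hC hα' hA hCA)).symm)
      refine .input fun i => ih (hCA i) ?_ (hn i) ht h
      have := height_lt_input w i
      simp only [height] at hN
      omega
    · have hα' := (hC.2.1 α).symm.trans hα
      have hA := isReplace_replace C α (X k)
      have hCA := hC.replace_left hD hA
      refine (Equivalent.of_eq (normalCut_output_left hC hα' hA hCA)).trans (.trans ?_ (Equivalent.of_eq (normalCut_output_left hC hα' hA hCA)).symm)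
      refine .output (ih hCA ?_ hn ht h)
      simp only [height] at hN
      omega

theorem normalCut_equivalent_right {w : Term P C₁} (hn : w.Normal) {t t' : Term P C₂}
    (ht : t.Normal) (h : Equivalent t t') : Equivalent (normalCut hC w t) (normalCut hC w t') := by
  have key : (t.Normal ↔ t'.Normal) ∧
      (t.Normal → Equivalent (normalCut hC w t) (normalCut hC w t')) := by
    clear ht
    induction h with
    | rel _ _ h =>
      exact ⟨normal_iff_of_inside h,
        fun ht => normalCut_converts_right_aux _ hC (Nat.lt_succ_self _) hn ht h⟩
    | refl => exact ⟨.rfl, fun _ => .refl _⟩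
    | symm _ _ _ ih => exact ⟨ih.1.symm, fun ht => (ih.2 (ih.1.2 ht)).symm⟩
    | trans _ _ _ _ _ ih ih' =>
      exact ⟨ih.1.trans ih'.1, fun ht => (ih.2 ht).trans (ih'.2 (ih.1.1 ht))⟩
  exact key.2 ht

end

/-! ### Cuts of normal terms -/

section

variable {V : Type} {C : Sequent P.Obj V} {S : Set V} {Z : Formula P.Obj}
  {C₁ : Sequent P.Obj (Option S)} {C₂ : Sequent P.Obj (Option ↥Sᶜ)} (hC : IsCut C S Z C₁ C₂)

include hC in
-- The cut formula decides: an atom leaves two trees of polymaps, a compound formula leaves a dual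
-- pair of operations on the cut channel.
theorem noneHeaded_cases {f : Term P C₁} {g : Term P C₂} (hf : f.NoneHeaded) (hg : g.NoneHeaded)
    (hfn : f.Normal) (hgn : g.Normal) :
    (f.AtomTree ∧ g.AtomTree) ∨
    (∃ n X k hα C₁' hC₁' hβ C₂' hC₂', ∃ (f' : Term P C₁') (g' : ∀ i, Term P (C₂' i)),
      f'.Normal ∧ (∀ i, (g' i).Normal) ∧ f = .output none .cod n X k hα C₁' hC₁' f' ∧
        g = .input none .dom n X hβ C₂' hC₂' g') ∨
    (∃ n X k hα C₁' hC₁' hβ C₂' hC₂', ∃ (f' : ∀ i, Term P (C₁' i)) (g' : Term P C₂'),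
      (∀ i, (f' i).Normal) ∧ g'.Normal ∧ f = .input none .cod n X hα C₁' hC₁' f' ∧
        g = .output none .dom n X k hβ C₂' hC₂' g') := by
  cases Z with
  | atom a => exact .inl ⟨hf.atomTree hC.1 hfn, hg.atomTree hC.2.2.1 hgn⟩
  | big c n X =>
    rcases hf.big_cases hC.1 hfn with ⟨-, hα, C₁', hC₁', f', hf', rfl⟩ |
      ⟨-, k, hα, C₁', hC₁', f', hf', rfl⟩
    · obtain ⟨-, k, hβ, C₂', hC₂', g', hg', rfl⟩ := NoneHeaded.right_of_input hC hα hg hgn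
      exact .inr (.inr ⟨n, X, k, hα, C₁', hC₁', hβ, C₂', hC₂', f', g', hf', hg', rfl, rfl⟩)
    · obtain ⟨-, hβ, C₂', hC₂', g', hg', rfl⟩ := NoneHeaded.right_of_output hC hα hg hgn
      exact .inr (.inl ⟨n, X, k, hα, C₁', hC₁', hβ, C₂', hC₂', f', g', hf', hg', rfl, rfl⟩)

theorem normalCut_eq_leafCut {f : Term P C₁} {g : Term P C₂} (hf : f.AtomTree) (hg : g.AtomTree) :
    normalCut hC f g = leafCut hC f g := by
  cases f with
  | input => exact hf.elim
  | output => exact hf.elim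
  | _ =>
    cases g with
    | input => exact hg.elim
    | output => exact hg.elim
    | _ => rw [normalCut] <;> simp

/-- `CutsTo hC f g t`: cut elimination for the cut of the cut-free terms `f` and `g` yields `t`. -/
inductive CutsTo : {V : Type} → {C : Sequent P.Obj V} → {S : Set V} → {Z : Formula P.Obj} →
    {C₁ : Sequent P.Obj (Option S)} → {C₂ : Sequent P.Obj (Option ↥Sᶜ)} → IsCut C S Z C₁ C₂ →
    Term P C₁ → Term P C₂ → Term P C → Prop
  | leaf {V : Type} {C : Sequent P.Obj V} {S : Set V} {Z C₁ C₂} {hC : IsCut C S Z C₁ C₂}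
      {f : Term P C₁} {g : Term P C₂} : f.AtomTree → g.AtomTree → CutsTo hC f g (leafCut hC f g)
  | input_left {V : Type} {C : Sequent P.Obj V} {S : Set V} {Z C₁ C₂} {hC : IsCut C S Z C₁ C₂}
      {α : S} {s n X hα C₁' hC₁'} {f : ∀ i, Term P (C₁' i)} {g : Term P C₂} {hα' D hD}
      {hC' : ∀ i, IsCut (D i) S Z (C₁' i) C₂} {t : ∀ i, Term P (D i)} :
      (∀ i, CutsTo (hC' i) (f i) g (t i)) →
      CutsTo (C := C) hC (.input (some α) s n X hα C₁' hC₁' f) g (.input α.1 s n X hα' D hD t)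
  | output_left {V : Type} {C : Sequent P.Obj V} {S : Set V} {Z C₁ C₂} {hC : IsCut C S Z C₁ C₂}
      {α : S} {s n X k hα C₁' hC₁'} {f : Term P C₁'} {g : Term P C₂} {hα' D hD}
      {hC' : IsCut D S Z C₁' C₂} {t : Term P D} : CutsTo hC' f g t →
      CutsTo (C := C) hC (.output (some α) s n X k hα C₁' hC₁' f) g
        (.output α.1 s n X k hα' D hD t)
  | input_right {V : Type} {C : Sequent P.Obj V} {S : Set V} {Z C₁ C₂} {hC : IsCut C S Z C₁ C₂}
      {β : ↥Sᶜ} {s n X hβ C₂' hC₂'} {f : Term P C₁} {g : ∀ i, Term P (C₂' i)} {hβ' D hD}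
      {hC' : ∀ i, IsCut (D i) S Z C₁ (C₂' i)} {t : ∀ i, Term P (D i)} : f.NoneHeaded →
      (∀ i, CutsTo (hC' i) f (g i) (t i)) →
      CutsTo (C := C) hC f (.input (some β) s n X hβ C₂' hC₂' g) (.input β.1 s n X hβ' D hD t)
  | output_right {V : Type} {C : Sequent P.Obj V} {S : Set V} {Z C₁ C₂} {hC : IsCut C S Z C₁ C₂}
      {β : ↥Sᶜ} {s n X k hβ C₂' hC₂'} {f : Term P C₁} {g : Term P C₂'} {hβ' D hD}
      {hC' : IsCut D S Z C₁ C₂'} {t : Term P D} : f.NoneHeaded → CutsTo hC' f g t →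
      CutsTo (C := C) hC f (.output (some β) s n X k hβ C₂' hC₂' g)
        (.output β.1 s n X k hβ' D hD t)
  | injection_cotuple {V : Type} {C : Sequent P.Obj V} {S : Set V} {Z C₁ C₂}
      {hC : IsCut C S Z C₁ C₂} {n X k hγ C₁' hC₁' hγ' C₂' hC₂'}
      {f : Term P C₁'} {g : ∀ i, Term P (C₂' i)} {hC' : IsCut C S (X k) C₁' (C₂' k)}
      {t : Term P C} : CutsTo hC' f (g k) t →
      CutsTo (C := C) hC (.output none .cod n X k hγ C₁' hC₁' f)
        (.input none .dom n X hγ' C₂' hC₂' g) t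
  | tuple_projection {V : Type} {C : Sequent P.Obj V} {S : Set V} {Z C₁ C₂}
      {hC : IsCut C S Z C₁ C₂} {n X k hγ C₁' hC₁' hγ' C₂' hC₂'}
      {f : ∀ i, Term P (C₁' i)} {g : Term P C₂'} {hC' : IsCut C S (X k) (C₁' k) C₂'}
      {t : Term P C} : CutsTo hC' (f k) g t →
      CutsTo (C := C) hC (.input none .cod n X hγ C₁' hC₁' f)
        (.output none .dom n X k hγ' C₂' hC₂' g) t

/-- The ill-typed combinations of heads are excluded here once and for all. What remains is an
induction principle for `normalCut` with exactly the meaningful cases. -/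
theorem cutsTo_normalCut {f : Term P C₁} {g : Term P C₂} (hf : f.Normal) (hg : g.Normal) :
    CutsTo hC f g (normalCut hC f g) := by
  obtain ⟨N, hN⟩ : ∃ N, f.height + g.height < N := ⟨_, Nat.lt_succ_self _⟩
  induction N generalizing V S Z with
  | zero => omega
  | succ N ih =>
    rcases noneHeaded_or f with hf' | ⟨α, s, n, X, hα, D, hD, f, rfl⟩ |
      ⟨α, s, n, X, k, hα, D, hD, f, rfl⟩
    · rcases noneHeaded_or g with hg' | ⟨α, s, n, X, hα, D, hD, g, rfl⟩ |
        ⟨α, s, n, X, k, hα, D, hD, g, rfl⟩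
      · rcases noneHeaded_cases hC hf' hg' hf hg with ⟨hf, hg⟩ |
          ⟨n, X, k, hα, C₁', hC₁', hβ, C₂', hC₂', f, g, hf, hg, rfl, rfl⟩ |
          ⟨n, X, k, hα, C₁', hC₁', hβ, C₂', hC₂', f, g, hf, hg, rfl, rfl⟩
        · rw [normalCut_eq_leafCut hC hf hg]
          exact .leaf hf hg
        · have hK := hC.replace_none hC₁' (hC₂' k)
          rw [normalCut_injection_cotuple hC hK]
          refine .injection_cotuple (ih hK hf (hg k) ?_)
          have := height_lt_input g k
          simp only [height] at hN
          omega
        · have hK := hC.replace_none (hC₁' k) hC₂'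
          rw [normalCut_tuple_projection hC hK]
          refine .tuple_projection (ih hK (hf k) hg ?_)
          have := height_lt_input f k
          simp only [height] at hN
          omega
      · have hA := fun i => isReplace_replace C α (X i)
        have hK := fun i => hC.replace_right (hD i) (hA i)
        rw [normalCut_input_right' hC hf' ((hC.2.2.2 α).symm.trans hα) hA hK]
        refine .input_right hf' fun i => ih (hK i) hf (hg i) ?_
        have := height_lt_input g i
        simp only [height] at hN
        omega
      · have hA := isReplace_replace C α (X k)
        have hK := hC.replace_right hD hA
        rw [normalCut_output_right' hC hf' ((hC.2.2.2 α).symm.trans hα) hA hK]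
        refine .output_right hf' (ih hK hf hg ?_)
        simp only [height] at hN
        omega
    · have hA := fun i => isReplace_replace C α (X i)
      have hK := fun i => hC.replace_left (hD i) (hA i)
      rw [normalCut_input_left hC ((hC.2.1 α).symm.trans hα) hA hK]
      refine .input_left fun i => ih (hK i) (hf i) hg ?_
      have := height_lt_input f i
      simp only [height] at hN
      omega
    · have hA := isReplace_replace C α (X k)
      have hK := hC.replace_left hD hA
      rw [normalCut_output_left hC ((hC.2.1 α).symm.trans hα) hA hK]
      refine .output_left (ih hK hf hg ?_)
      simp only [height] at hN
      omega

theorem AtomTree.rename {V W : Type} {C : Sequent P.Obj V} {t : Term P C} (ht : t.AtomTree)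
    (r : V ≃ W) (D : Sequent P.Obj W) (h : ∀ α, D (r α) = C α) : (t.rename r D h).AtomTree := by
  induction t generalizing W with
  | atom => simp only [Term.rename, AtomTree]
  | input => exact ht.elim
  | output => exact ht.elim
  | cut S Z C₁ C₂ hC f g ihf ihg =>
    simp only [Term.rename, AtomTree]
    exact ⟨ihf ht.1 _ _ _, ihg ht.2 _ _ _⟩

theorem leafCut_normal {f : Term P C₁} {g : Term P C₂} (hf : f.AtomTree) (hg : g.AtomTree) :
    (leafCut hC f g).Normal := by
  unfold leafCut
  split_ifs
  · exact (hg.rename _ _ _).normal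
  · exact (hf.rename _ _ _).normal
  · exact ⟨hf, hg⟩

theorem normalCut_normal {f : Term P C₁} {g : Term P C₂} (hf : f.Normal) (hg : g.Normal) :
    (normalCut hC f g).Normal := by
  have h := cutsTo_normalCut hC hf hg
  generalize normalCut hC f g = t at h
  clear hf hg
  induction h with
  | leaf hf hg => exact leafCut_normal _ hf hg
  | input_left _ ih => exact ih
  | output_left _ ih => exact ih
  | input_right _ _ ih => exact ih
  | output_right _ _ ih => exact ih
  | injection_cotuple _ ih => exact ih
  | tuple_projection _ ih => exact ih

theorem Rewrite.reducesTo {t t' t'' : Term P C} (h : Rewrite t t') (h' : ReducesTo t' t'') :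
    ReducesTo t t'' :=
  .head (.root h) h'

theorem cut_reducesTo_leafCut (f : Term P C₁) (g : Term P C₂) :
    ReducesTo (.cut S Z C₁ C₂ hC f g) (leafCut hC f g) := by
  unfold leafCut
  split_ifs with h h'
  · exact (Rewrite.id_cut _ h.2.choose_spec.1 _ h.1).reducesTo .refl
  · exact (Rewrite.cut_id _ h'.2.choose_spec.1 _ h'.1).reducesTo .refl
  · exact .refl

/-- Every non-leaf case of `CutsTo` is a single rewrite followed by cuts of smaller terms; a leaf
takes at most one identity rewrite. -/
theorem cut_reducesTo_normalCut {f : Term P C₁} {g : Term P C₂} (hf : f.Normal) (hg : g.Normal) :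
    ReducesTo (.cut S Z C₁ C₂ hC f g) (normalCut hC f g) := by
  have h := cutsTo_normalCut hC hf hg
  generalize normalCut hC f g = t at h
  clear hf hg
  induction h with
  | leaf => exact cut_reducesTo_leafCut _ _ _
  | input_left _ ih => exact Rewrite.input_cut.reducesTo (.input ih)
  | output_left _ ih => exact Rewrite.output_cut.reducesTo (.output ih)
  | input_right _ _ ih => exact Rewrite.cut_input.reducesTo (.input ih)
  | output_right _ _ ih => exact Rewrite.cut_output.reducesTo (.output ih)
  | injection_cotuple _ ih => exact Rewrite.injection_cotuple.reducesTo ih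
  | tuple_projection _ ih => exact Rewrite.tuple_projection.reducesTo ih

/-! ### Cuts with identities -/

/-- The sequent determines the naming of the two channels by their sides, and the atom by its
formulas. -/
theorem IsIdentity.eq {V : Type} {C : Sequent P.Obj V} {t t' : Term P C} (h : t.IsIdentity)
    (h' : t'.IsIdentity) : t = t' := by
  obtain ⟨hV, a, r, hC, rfl⟩ := h
  obtain ⟨hV', a', r', hC', rfl⟩ := h'
  have h := fun α => (hC α).symm.trans (hC' α)
  simp only [Prod.mk.injEq, Formula.atom.injEq] at h
  obtain rfl : r = r' := Equiv.symm_bijective.injective (Equiv.ext fun α => (h α).1)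
  obtain rfl : a = a' := (h (r .dom)).2
  rfl

/-- A bijection is determined by its values away from one point. So the renaming chosen in `leafCut`
agrees with the one in any given identity rewrite. -/
theorem optionEquiv_ext {A B : Type} {r r' : Option A ≃ B} (h : ∀ a, r (some a) = r' (some a)) :
    r = r' := by
  refine Equiv.ext fun x => ?_
  cases x with
  | some a => exact h a
  | none =>
    rcases hx : r'.symm (r none) with _ | a
    · have := congrArg r' hx
      rwa [Equiv.apply_symm_apply] at this
    · have : r none = r (some a) := by rw [h, ← hx, Equiv.apply_symm_apply]
      simpa using r.injective this

theorem FillsNone.unique {D : Sequent P.Obj (Option S)} {r r' : Option S ≃ V}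
    (h : FillsNone C D r) (h' : FillsNone C D r') : r = r' :=
  optionEquiv_ext fun α => (h.1 α).trans (h'.1 α).symm

theorem leafCut_of_left {f : Term P C₁} {g : Term P C₂} (hf : f.IsIdentity) {r : Option ↥Sᶜ ≃ V}
    (hr : FillsNone C C₂ r) : leafCut hC f g = g.rename r C hr.2 := by
  have h : f.IsIdentity ∧ ∃ r : Option ↥Sᶜ ≃ V, FillsNone C C₂ r := ⟨hf, r, hr⟩
  rw [leafCut, dif_pos h]
  exact eq_of_heq (rename_heq (h.2.choose_spec.unique hr) rfl _ _ _)

theorem leafCut_of_right {f : Term P C₁} {g : Term P C₂} (hg : g.IsIdentity) {r : Option S ≃ V}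
    (hr : FillsNone C C₁ r) : leafCut hC f g = f.rename r C hr.2 := by
  by_cases h : f.IsIdentity ∧ ∃ r : Option ↥Sᶜ ≃ V, FillsNone C C₂ r
  · obtain ⟨hf, r', hr'⟩ := h
    rw [leafCut_of_left hC hf hr']
    -- When both premises are identities, either rewrite yields an identity on the same sequent, so
    -- the preference for the left one is immaterial.
    exact (hg.rename _ _ _).eq (hf.rename _ _ _)
  · have h' : g.IsIdentity ∧ ∃ r : Option S ≃ V, FillsNone C C₁ r := ⟨hg, r, hr⟩
    rw [leafCut, dif_neg h, dif_pos h']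
    exact eq_of_heq (rename_heq (h'.2.choose_spec.unique hr) rfl _ _ _)

theorem IsReplace.apply_equiv {O : Type u} {V W : Type} {C C' : Sequent O V} {D D' : Sequent O W}
    {α : V} {β : W} {X : Formula O} {r : V ≃ W} (hr : r α = β) (hD : ∀ γ, D (r γ) = C γ)
    (h : IsReplace C α X C') (h' : IsReplace D β X D') (γ : V) : D' (r γ) = C' γ := by
  subst hr
  by_cases hγ : γ = α
  · rw [hγ, h.1, h'.1, hD]
  · rw [h.2 γ hγ, h'.2 _ (by simpa using hγ), hD]

theorem rename_input {V W : Type} {C : Sequent P.Obj V} {D : Sequent P.Obj W} {r : V ≃ W}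
    {h : ∀ γ, D (r γ) = C γ} {α : V} {β : W} (hr : r α = β) {s n X hα C' hC'}
    {f : ∀ i, Term P (C' i)} {D'} (hβ) (hD' : ∀ i, IsReplace D β (X i) (D' i)) :
    rename r D h (.input α s n X hα C' hC' f) = .input β s n X hβ D' hD'
      (fun i => rename r (D' i) (IsReplace.apply_equiv hr h (hC' i) (hD' i)) (f i)) := by
  subst hr
  obtain rfl : D' = fun i w => C' i (r.symm w) :=
    funext fun i => (hD' i).unique ((hC' i).rename r h)
  rfl

theorem rename_output {V W : Type} {C : Sequent P.Obj V} {D : Sequent P.Obj W} {r : V ≃ W}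
    {h : ∀ γ, D (r γ) = C γ} {α : V} {β : W} (hr : r α = β) {s n X k hα C' hC'}
    {f : Term P C'} {D'} (hβ) (hD' : IsReplace D β (X k) D') :
    rename r D h (.output α s n X k hα C' hC' f) = .output β s n X k hβ D' hD'
      (rename r D' (IsReplace.apply_equiv hr h hC' hD') f) := by
  subst hr
  obtain rfl : D' = fun w => C' (r.symm w) := hD'.unique (hC'.rename r h)
  rfl

theorem IsIdentity.normal {t : Term P C} (h : t.IsIdentity) : t.Normal := by
  obtain ⟨_, _, _, _, rfl⟩ := h
  trivial

theorem not_isIdentity_input {α : V} {s n X hα C' hC'} {f : ∀ i, Term P (C' i)} :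
    ¬ (Term.input (C := C) α s n X hα C' hC' f).IsIdentity := by
  rintro ⟨_, _, _, _, h⟩
  cases h

theorem not_isIdentity_output {α : V} {s n X k hα C' hC'} {f : Term P C'} :
    ¬ (Term.output (C := C) α s n X k hα C' hC' f).IsIdentity := by
  rintro ⟨_, _, _, _, h⟩
  cases h

/-- An identity has no input or output, so it is carried unchanged through the operations of `g` to
the leaves, where it is absorbed. -/
theorem normalCut_identity_left {f : Term P C₁} {g : Term P C₂} (hf : f.IsIdentity)
    (hg : g.Normal) (r : Option ↥Sᶜ ≃ V) (hr : ∀ α : ↥Sᶜ, r (some α) = α)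
    (hD : ∀ α, C (r α) = C₂ α) : normalCut hC f g = g.rename r C hD := by
  have h := cutsTo_normalCut hC hf.normal hg
  generalize normalCut hC f g = t at h
  clear hg
  induction h with
  | leaf => exact leafCut_of_left _ hf ⟨hr, hD⟩
  | input_left => exact absurd hf not_isIdentity_input
  | output_left => exact absurd hf not_isIdentity_output
  | @input_right _ _ _ _ _ _ β _ _ _ _ _ _ _ _ hβ' _ hD' _ _ _ _ ih =>
    rw [rename_input (hr β) hβ' hD']
    congr 1
    funext i
    exact ih i hf r hr _
  | @output_right _ _ _ _ _ _ β _ _ _ _ _ _ _ _ _ hβ' _ hD' _ _ _ _ ih =>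
    rw [rename_output (hr β) hβ' hD']
    congr 1
    exact ih hf r hr _
  | injection_cotuple => exact absurd hf not_isIdentity_output
  | tuple_projection => exact absurd hf not_isIdentity_input

theorem normalCut_identity_right {f : Term P C₁} {g : Term P C₂} (hg : g.IsIdentity)
    (hf : f.Normal) (r : Option S ≃ V) (hr : ∀ α : S, r (some α) = α)
    (hD : ∀ α, C (r α) = C₁ α) : normalCut hC f g = f.rename r C hD := by
  have h := cutsTo_normalCut hC hf hg.normal
  generalize normalCut hC f g = t at h
  clear hf
  induction h with
  | leaf => exact leafCut_of_right _ hg ⟨hr, hD⟩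
  | input_right => exact absurd hg not_isIdentity_input
  | output_right => exact absurd hg not_isIdentity_output
  | @input_left _ _ _ _ _ _ β _ _ _ _ _ _ _ _ hβ' _ hD' _ _ _ ih =>
    rw [rename_input (hr β) hβ' hD']
    congr 1
    funext i
    exact ih i hg r hr _
  | @output_left _ _ _ _ _ _ β _ _ _ _ _ _ _ _ _ hβ' _ hD' _ _ _ ih =>
    rw [rename_output (hr β) hβ' hD']
    congr 1
    exact ih hg r hr _
  | injection_cotuple => exact absurd hg not_isIdentity_input
  | tuple_projection => exact absurd hg not_isIdentity_output

end

/-! ### Renaming and cut elimination -/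

section

variable {V : Type} {C : Sequent P.Obj V} {S : Set V} {Z : Formula P.Obj}
  {C₁ : Sequent P.Obj (Option S)} {C₂ : Sequent P.Obj (Option ↥Sᶜ)}

theorem NoneHeaded.rename {W : Type} {t : Term P C₁} (ht : t.NoneHeaded) {T : Set W} (r : V ≃ W)
    (hT : ∀ v, v ∈ S ↔ r v ∈ T) (D : Sequent P.Obj (Option T)) (h) :
    (t.rename (cutEquiv r S T hT) D h).NoneHeaded := by
  match t, ht with
  | @Term.atom _ _ _ _ _ _ _, _ => trivial
  | .cut _ _ _ _ _ _ _, _ => trivial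
  | .input none _ _ _ _ _ _ _, _ => trivial
  | .output none _ _ _ _ _ _ _ _, _ => trivial

theorem FillsNone.rename {W : Type} {r : Option S ≃ V} (hr : FillsNone C C₁ r) {T : Set W}
    (ρ : V ≃ W) (hT : ∀ v, v ∈ S ↔ ρ v ∈ T) {D : Sequent P.Obj W} (hD : ∀ α, D (ρ α) = C α)
    {D₁ : Sequent P.Obj (Option T)} (h₁ : ∀ α, D₁ (cutEquiv ρ S T hT α) = C₁ α) :
    FillsNone D D₁ ((cutEquiv ρ S T hT).symm.trans (r.trans ρ)) := by
  refine ⟨fun β => ?_, fun β => ?_⟩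
  · obtain ⟨α, rfl⟩ := (ρ.subtypeEquiv hT).surjective β
    have : (cutEquiv ρ S T hT).symm (some (ρ.subtypeEquiv hT α)) = some α := by
      rw [Equiv.symm_apply_eq]
      rfl
    simp only [Equiv.trans_apply, this, hr.1]
    rfl
  · obtain ⟨α, rfl⟩ := (cutEquiv ρ S T hT).surjective β
    simp only [Equiv.trans_apply, Equiv.symm_apply_apply, hD, hr.2, h₁]

theorem exists_fillsNone_of_rename {W : Type} {T : Set W} (ρ : V ≃ W)
    (hT : ∀ v, v ∈ S ↔ ρ v ∈ T) {D : Sequent P.Obj W} (hD : ∀ α, D (ρ α) = C α)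
    {D₁ : Sequent P.Obj (Option T)} (h₁ : ∀ α, D₁ (cutEquiv ρ S T hT α) = C₁ α)
    {r : Option T ≃ W} (hr : FillsNone D D₁ r) : ∃ r, FillsNone C C₁ r := by
  refine ⟨(cutEquiv ρ S T hT).trans (r.trans ρ.symm), fun α => ?_, fun α => ?_⟩
  · have : r (cutEquiv ρ S T hT (some α)) = ρ α := hr.1 (ρ.subtypeEquiv hT α)
    simp [this]
  · rw [← h₁, ← hr.2, ← hD]
    simp

/-- The tests made by `leafCut` must be reflected as well as preserved by renaming, since a cut that
is kept has to stay a cut. -/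
theorem leafCut_rename {W : Type} (hC : IsCut C S Z C₁ C₂) (f : Term P C₁) (g : Term P C₂)
    (ρ : V ≃ W) {D : Sequent P.Obj W} (hD : ∀ α, D (ρ α) = C α)
    {D₁ : Sequent P.Obj (Option (ρ.symm ⁻¹' S))} {D₂ : Sequent P.Obj (Option ↥(ρ.symm ⁻¹' S)ᶜ)}
    (h₁ : ∀ α, D₁ (cutEquiv ρ S (ρ.symm ⁻¹' S) (by simp) α) = C₁ α)
    (h₂ : ∀ α, D₂ (cutEquiv ρ Sᶜ (ρ.symm ⁻¹' S)ᶜ (by simp) α) = C₂ α)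
    (hC' : IsCut D (ρ.symm ⁻¹' S) Z D₁ D₂) :
    (leafCut hC f g).rename ρ D hD = leafCut hC' (f.rename _ D₁ h₁) (g.rename _ D₂ h₂) := by
  by_cases hf : f.IsIdentity ∧ ∃ r : Option ↥Sᶜ ≃ V, FillsNone C C₂ r
  · obtain ⟨hf, r, hr⟩ := hf
    rw [leafCut_of_left hC hf hr, leafCut_of_left hC' (hf.rename _ _ _) (hr.rename ρ _ hD h₂),
      rename_trans, rename_trans]
    refine eq_of_heq (rename_heq ?_ rfl _ _ _)
    ext x
    simp
  by_cases hg : g.IsIdentity ∧ ∃ r : Option S ≃ V, FillsNone C C₁ r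
  · obtain ⟨hg, r, hr⟩ := hg
    rw [leafCut_of_right hC hg hr, leafCut_of_right hC' (hg.rename _ _ _) (hr.rename ρ _ hD h₁),
      rename_trans, rename_trans]
    refine eq_of_heq (rename_heq ?_ rfl _ _ _)
    ext x
    simp
  rw [leafCut, dif_neg hf, dif_neg hg, leafCut, dif_neg, dif_neg]
  · obtain rfl : D₁ = fun w => C₁ ((cutEquiv ρ S (ρ.symm ⁻¹' S) (by simp)).symm w) :=
      funext fun w => by rw [← h₁, Equiv.apply_symm_apply]
    obtain rfl : D₂ = fun w => C₂ ((cutEquiv ρ Sᶜ (ρ.symm ⁻¹' S)ᶜ (by simp)).symm w) :=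
      funext fun w => by rw [← h₂, Equiv.apply_symm_apply]
    rfl
  · rintro ⟨h, r, hr⟩
    exact hg ⟨(isIdentity_rename _ _ _).1 h, exists_fillsNone_of_rename ρ _ hD h₁ hr⟩
  · rintro ⟨h, r, hr⟩
    exact hf ⟨(isIdentity_rename _ _ _).1 h, exists_fillsNone_of_rename ρ _ hD h₂ hr⟩

/-- The strategy looks only at head operations and at identities, neither of which depends on names.
Hence an equality, and not merely conversions. -/
theorem normalCut_rename {W : Type} (hC : IsCut C S Z C₁ C₂) {f : Term P C₁} {g : Term P C₂}
    (hf : f.Normal) (hg : g.Normal) (ρ : V ≃ W) {D : Sequent P.Obj W} (hD : ∀ α, D (ρ α) = C α)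
    {D₁ : Sequent P.Obj (Option (ρ.symm ⁻¹' S))} {D₂ : Sequent P.Obj (Option ↥(ρ.symm ⁻¹' S)ᶜ)}
    (h₁ : ∀ α, D₁ (cutEquiv ρ S (ρ.symm ⁻¹' S) (by simp) α) = C₁ α)
    (h₂ : ∀ α, D₂ (cutEquiv ρ Sᶜ (ρ.symm ⁻¹' S)ᶜ (by simp) α) = C₂ α)
    (hC' : IsCut D (ρ.symm ⁻¹' S) Z D₁ D₂) :
    (normalCut hC f g).rename ρ D hD = normalCut hC' (f.rename _ D₁ h₁) (g.rename _ D₂ h₂) := by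
  have h := cutsTo_normalCut hC hf hg
  generalize normalCut hC f g = t at h
  clear hf hg
  induction h generalizing W with
  | leaf hf hg =>
    rw [normalCut_eq_leafCut hC' (hf.rename _ _ _) (hg.rename _ _ _)]
    exact leafCut_rename _ _ _ ρ hD h₁ h₂ hC'
  | @input_left _ T _ _ _ _ α s n X hα _ hC₁ _ _ hα' _ hD' _ _ _ ih =>
    let β : ↥(ρ.symm ⁻¹' T) := ⟨ρ α, by simp⟩
    have hβ : D₁ (some β) = _ := (h₁ (some α)).trans hα
    have hA := fun i => isReplace_replace D β.1 (X i)
    have hB := fun i => isReplace_replace D₁ (some β) (X i)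
    have hK := fun i => hC'.replace_left (hB i) (hA i)
    rw [rename_input (β := β.1) rfl ((hD _).trans hα') hA, rename_input (β := some β) rfl hβ hB,
      normalCut_input_left hC' ((hD _).trans hα') hA hK]
    congr 1
    funext i
    exact ih i ρ _ _ _ (hK i)
  | @output_left _ T _ _ _ _ α s n X k hα _ hC₁ _ _ hα' _ hD' _ _ _ ih =>
    let β : ↥(ρ.symm ⁻¹' T) := ⟨ρ α, by simp⟩
    have hβ : D₁ (some β) = _ := (h₁ (some α)).trans hα
    have hA := isReplace_replace D β.1 (X k)
    have hB := isReplace_replace D₁ (some β) (X k)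
    have hK := hC'.replace_left hB hA
    rw [rename_output (β := β.1) rfl ((hD _).trans hα') hA, rename_output (β := some β) rfl hβ hB,
      normalCut_output_left hC' ((hD _).trans hα') hA hK]
    congr 1
    exact ih ρ _ _ _ hK
  | @input_right _ T _ _ _ _ α s n X hα _ hC₂ _ _ hα' _ hD' _ _ hf _ ih =>
    let β : ↥(ρ.symm ⁻¹' T)ᶜ := ⟨ρ α, fun h =>
      α.2 (by rwa [Set.mem_preimage, Equiv.symm_apply_apply] at h)⟩
    have hβ : D₂ (some β) = _ := (h₂ (some α)).trans hα
    have hA := fun i => isReplace_replace D β.1 (X i)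
    have hB := fun i => isReplace_replace D₂ (some β) (X i)
    have hK := fun i => hC'.replace_right (hB i) (hA i)
    rw [rename_input (β := β.1) rfl ((hD _).trans hα') hA, rename_input (β := some β) rfl hβ hB,
      normalCut_input_right' hC' (hf.rename ρ _ _ _) ((hD _).trans hα') hA hK]
    congr 1
    funext i
    exact ih i ρ _ _ _ (hK i)
  | @output_right _ T _ _ _ _ α s n X k hα _ hC₂ _ _ hα' _ hD' _ _ hf _ ih =>
    let β : ↥(ρ.symm ⁻¹' T)ᶜ := ⟨ρ α, fun h =>
      α.2 (by rwa [Set.mem_preimage, Equiv.symm_apply_apply] at h)⟩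
    have hβ : D₂ (some β) = _ := (h₂ (some α)).trans hα
    have hA := isReplace_replace D β.1 (X k)
    have hB := isReplace_replace D₂ (some β) (X k)
    have hK := hC'.replace_right hB hA
    rw [rename_output (β := β.1) rfl ((hD _).trans hα') hA, rename_output (β := some β) rfl hβ hB,
      normalCut_output_right' hC' (hf.rename ρ _ _ _) ((hD _).trans hα') hA hK]
    congr 1
    exact ih ρ _ _ _ hK
  | @injection_cotuple _ _ _ _ _ _ n X k hα _ _ hα' _ _ _ _ _ _ _ ih =>
    have hα₁ : D₁ none = _ := (h₁ none).trans hα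
    have hα₂ : D₂ none = _ := (h₂ none).trans hα'
    have hA := isReplace_replace D₁ none (X k)
    have hB := fun i => isReplace_replace D₂ none (X i)
    have hK := hC'.replace_none hA (hB k)
    rw [rename_output (β := none) rfl hα₁ hA,
      rename_input (β := none) rfl hα₂ hB,
      normalCut_injection_cotuple hC' (X := X) (k := k) (C₂' := fun i => replace D₂ none (X i)) hK]
    exact ih ρ _ _ _ hK
  | @tuple_projection _ _ _ _ _ _ n X k hα _ _ hα' _ _ _ _ _ _ _ ih =>
    have hα₁ : D₁ none = _ := (h₁ none).trans hα
    have hα₂ : D₂ none = _ := (h₂ none).trans hα'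
    have hA := fun i => isReplace_replace D₁ none (X i)
    have hB := isReplace_replace D₂ none (X k)
    have hK := hC'.replace_none (hA k) hB
    rw [rename_input (β := none) rfl hα₁ hA,
      rename_output (β := none) rfl hα₂ hB,
      normalCut_tuple_projection hC' (X := X) (k := k) (C₁' := fun i => replace D₁ none (X i)) hK]
    exact ih ρ _ _ _ hK

end

/-! ### The normal form of a term -/

/-- The cut-free form of a term, computed by eliminating innermost cuts first. -/
noncomputable def eval : {V : Type} → {C : Sequent P.Obj V} → Term P C → Term P C
  | _, _, @Term.atom _ _ hV _ A m hC => @Term.atom _ _ hV _ A m hC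
  | _, _, .input α s n X hα C' hC' f => .input α s n X hα C' hC' fun i => eval (f i)
  | _, _, .output α s n X k hα C' hC' f => .output α s n X k hα C' hC' (eval f)
  | _, _, .cut _ _ _ _ hC f g => normalCut hC (eval f) (eval g)

section

variable {V : Type} {C : Sequent P.Obj V}

theorem eval_normal (t : Term P C) : t.eval.Normal := by
  induction t with
  | atom => trivial
  | input _ _ _ _ _ _ _ f ih => exact ih
  | output _ _ _ _ _ _ _ _ f ih => exact ih
  | cut _ _ _ _ hC f g ihf ihg => exact normalCut_normal hC ihf ihg

theorem reducesTo_eval (t : Term P C) : ReducesTo t t.eval := by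
  induction t with
  | atom => exact .refl
  | input _ _ _ _ _ _ _ f ih => exact .input ih
  | output _ _ _ _ _ _ _ _ f ih => exact .output ih
  | cut _ _ _ _ hC f g ihf ihg =>
    exact Relation.ReflTransGen.trans (ReducesTo.cut ihf ihg)
      (cut_reducesTo_normalCut hC (eval_normal f) (eval_normal g))

theorem eval_rename (t : Term P C) {W : Type} (r : V ≃ W) (D : Sequent P.Obj W)
    (h : ∀ α, D (r α) = C α) : (t.rename r D h).eval = t.eval.rename r D h := by
  induction t generalizing W with
  | atom => simp only [rename, eval]
  | input _ _ _ _ _ _ _ f ih => simp only [rename, eval, ih]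
  | output _ _ _ _ _ _ _ _ f ih => simp only [rename, eval, ih]
  | cut _ _ _ _ hC f g ihf ihg =>
    simp only [rename, eval, ihf, ihg]
    exact (normalCut_rename hC (eval_normal f) (eval_normal g) r h _ _ _).symm

theorem IsIdentity.eval_eq {t : Term P C} (h : t.IsIdentity) : t.eval = t := by
  obtain ⟨_, _, _, _, rfl⟩ := h
  rfl

/-- Only the commutations with the right premise cost conversions; all other rewrites become
equalities. -/
theorem Rewrite.eval_equivalent {t t' : Term P C} (h : Rewrite t t') :
    Equivalent t.eval t'.eval := by
  cases h with
  | @cut_id _ _ _ _ hC f g r hr hD hg =>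
    rw [eval_rename, eval, hg.eval_eq]
    exact .of_eq (normalCut_identity_right hC hg (eval_normal f) r hr hD)
  | @id_cut _ _ _ _ hC f g r hr hD hf =>
    rw [eval_rename, eval, hf.eval_eq]
    exact .of_eq (normalCut_identity_left hC hf (eval_normal g) r hr hD)
  | input_cut => simpa only [eval] using Equivalent.of_eq (normalCut_input_left _ _ _ _)
  | output_cut => simpa only [eval] using Equivalent.of_eq (normalCut_output_left _ _ _ _)
  | cut_input => simpa only [eval] using normalCut_input_right _ _ _ _
  | cut_output => simpa only [eval] using normalCut_output_right _ _ _ _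
  | injection_cotuple =>
    simpa only [eval] using Equivalent.of_eq (normalCut_injection_cotuple _ _)
  | tuple_projection =>
    simpa only [eval] using Equivalent.of_eq (normalCut_tuple_projection _ _)

/-- Evaluation leaves inputs and outputs in place, so the same conversion applies to the evaluated
subterms. -/
theorem Interchange.eval_equivalent {t t' : Term P C} (h : Interchange (fun _ => True) t t') :
    Equivalent t.eval t'.eval := by
  cases h with
  | input_input hne => exact (Interchange.input_input hne trivial trivial).equivalent
  | input_output hne => exact (Interchange.input_output hne trivial).equivalent
  | output_output hne => exact (Interchange.output_output hne).equivalent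

/-- Inputs and outputs are congruences trivially. Under a cut the claim is the invariance of
`normalCut`, applicable because evaluated terms are normal. -/
theorem Inside.eval_equivalent
    {R : ∀ {V : Type} {C : Sequent P.Obj V}, Term P C → Term P C → Prop}
    (hR : ∀ {V : Type} {C : Sequent P.Obj V} {t t' : Term P C}, R t t' →
      Equivalent t.eval t'.eval) {t t' : Term P C} (h : Inside R t t') :
    Equivalent t.eval t'.eval := by
  induction h with
  | root h => exact hR h
  | input i _ hij ih =>
    refine Equivalent.input fun j => ?_
    by_cases hj : j = i
    · exact hj ▸ ih
    · exact .of_eq (by rw [hij j hj])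
  | output _ ih => exact Equivalent.output ih
  | @cut_left _ _ _ _ _ _ hC f f' g _ ih =>
    exact normalCut_equivalent_left hC (eval_normal g) (eval_normal f) ih
  | @cut_right _ _ _ _ _ _ hC f g g' _ ih =>
    exact normalCut_equivalent_right hC (eval_normal f) (eval_normal g) ih

theorem eval_equivalent_of_eqvGen {t u : Term P C}
    (h : Relation.EqvGen (fun a b => a.Reduces b ∨ a.Converts b) t u) :
    Equivalent t.eval u.eval := by
  induction h with
  | rel _ _ h =>
    rcases h with h | h
    · exact Inside.eval_equivalent Rewrite.eval_equivalent h
    · exact Inside.eval_equivalent Interchange.eval_equivalent h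
  | refl => exact .refl _
  | symm _ _ _ ih => exact ih.symm
  | trans _ _ _ _ _ ih ih' => exact ih.trans ih'

end

end Term

end SigmaPi

theorem mainTheorem4 (P : SigmaPi.Polycategory.{u, v}) {V : Type} [Finite V]
    (C : SigmaPi.Sequent P.Obj V) :
    (∀ t u : SigmaPi.Term P C,
      Relation.EqvGen (fun a b => a.Reduces b ∨ a.Converts b) t u →
      ∃ t' u' : SigmaPi.Term P C,
        Relation.ReflTransGen SigmaPi.Term.Reduces t t' ∧
        Relation.ReflTransGen SigmaPi.Term.Reduces u u' ∧
        Relation.EqvGen SigmaPi.Term.Converts t' u') ∧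
    (∀ t u : SigmaPi.Term P C, t.Reduces u →
      Multiset.IsDershowitzMannaLT u.cutHeights t.cutHeights) ∧
    (∀ t u : SigmaPi.Term P C, t.ConvertsNonNullary u → t.cutHeights = u.cutHeights) :=
  -- The evaluations serve as the reducts.
  ⟨fun t u h => ⟨t.eval, u.eval, t.reducesTo_eval, u.reducesTo_eval,
      SigmaPi.Term.eval_equivalent_of_eqvGen h⟩,
    fun _ _ h => h.cutHeights_lt, fun _ _ h => h.heights_eq.2⟩
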